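/- For $q\ge 1$ let $f(s)=e^{e^{s^q}}$ $(s\ge 0)$ and $F(s)=\int_s^\infty \frac{d\tau}{f(\tau)}$. For a function $h>0$ with $H(s)=\int_s^\infty\frac{d\tau}{h(\tau)}<\infty$ for large $s$, put $$\frac1{B_1[h]}=(-\log H)\,(1-h'H),\qquad \frac1{B_2[h]}=h'H\,(-\log H)^2\Big[\frac{h\,h''H}{h'}-1\Big],$$ and call $B=\lim_{s\to\infty}B_2[h](s)$ the growth exponent of $h$. For growth exponent $B=1$ the model nonlinearity is $g(s)=4e^{e^s}/e^{2s}$, with $G(s)=\int_s^\infty \frac{d\tau}{g(\tau)}$ and $v(x)=\log\log\frac1{|x|^2}$, $x\in\mathbb R^2$. Let $\tilde u(x)=F^{-1}(G(v(x)))$ for small $x\ne0$, and $$R_i(x)=\Big|\frac1{B_i[f](\tilde u(x))}-\frac1{B_i[g](v(x))}\Big|,\qquad i=1,2.$$ The discrepancy condition for $f$ is $$\lim_{x\to0}(-\log|x|)^{1/2}\,[R_1(x)+R_2(x)]=0.$$ Then: 1. For every $q\ge1$, $F(s)<\infty$ for all large $s$, and $f$ has growth exponent $B=1$. 2. The discrepancy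 condition holds for $q=1$ and fails for every $q>1$. 3. For $q=1$ there exist $R>0$ and a nonnegative radial function $u\in C^\infty(B_R(0)\setminus\{0\})$ on the punctured disc in $\mathbb R^2$ with $-\Delta u=f(u)$ in $B_R(0)\setminus\{0\}$, $u(x)\to\infty$ as $x\to0$, and $$u(x)=\log\big[-\log w-\log(-\log w)\big]+O\Big(\frac{\log(-\log w)}{(-\log w)^2}\Big)\quad (x\to0),\qquad w=\tfrac14|x|^2\Big(\log\frac1{|x|^2}+1\Big).$$ -/

import Mathlib

open Real Set Filter Topology Asymptotics
open scoped ContDiff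

noncomputable section

namespace SingularSol

/-- The Euclidean plane. -/
abbrev Plane : Type := EuclideanSpace ℝ (Fin 2)

/-- The nonlinearity `f(s) = exp (exp (s ^ q))`, used for `s ≥ 0`. -/
def doubleExp (q : ℝ) (s : ℝ) : ℝ := exp (exp (s ^ q))

/-- `F(s) = ∫_s^∞ dτ / f(τ)`. -/
def tailIntegral (f : ℝ → ℝ) (s : ℝ) : ℝ := ∫ τ in Ioi s, 1 / f τ

/-- The inverse of `F : (0, ∞) → ℝ` (meaningful on the range of `F`). -/
def tailInverse (f : ℝ → ℝ) (w : ℝ) : ℝ :=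
  Function.invFunOn (tailIntegral f) (Ioi 0) w

/-- `1 / B₁[f](s) = (-log F(s)) (1 - f'(s) F(s))`. -/
def invB₁ (f : ℝ → ℝ) (s : ℝ) : ℝ :=
  (-log (tailIntegral f s)) * (1 - deriv f s * tailIntegral f s)

/-- `1 / B₂[f](s) = f'(s) F(s) (-log F(s))² (f(s) f''(s) F(s) / f'(s) - 1)`. -/
def invB₂ (f : ℝ → ℝ) (s : ℝ) : ℝ :=
  deriv f s * tailIntegral f s * (-log (tailIntegral f s)) ^ 2 *
    (f s * deriv (deriv f) s * tailIntegral f s / deriv f s - 1)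

/-- `B₂[f](s)`. -/
def B₂ (f : ℝ → ℝ) (s : ℝ) : ℝ := 1 / invB₂ f s

/-- The growth exponent of `f` exists and equals `B`: the integral `F(s)` converges for all large
`s`, and `B₂[f](s) → B` as `s → ∞`. -/
def HasGrowthExponent (f : ℝ → ℝ) (B : ℝ) : Prop :=
  (∀ᶠ s in atTop, MeasureTheory.IntegrableOn (fun τ => 1 / f τ) (Ioi s)) ∧
    Tendsto (B₂ f) atTop (𝓝 B)

/-- The explicit solution `v` of the model equation with growth exponent `B ≥ 1`
(`B' = B / (B - 1)` is the conjugate exponent if `B > 1`). -/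
def modelSolution (B : ℝ) (x : Plane) : ℝ :=
  if B = 1 then log (log (1 / ‖x‖ ^ 2)) else (log (1 / ‖x‖ ^ 2)) ^ (1 / B.conjExponent)

/-- The model nonlinearity `g` with growth exponent `B ≥ 1`. -/
def modelNonlinearity (B : ℝ) (s : ℝ) : ℝ :=
  if B = 1 then 4 * exp (exp s) / exp (2 * s)
  else 4 / (B * B.conjExponent) * s ^ (1 - 2 * B.conjExponent) * exp (s ^ B.conjExponent)

/-- The approximate solution `ũ(x) = F⁻¹(G(v(x)))`, where `G(s) = ∫_s^∞ dτ / g(τ)`. -/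
def approxSolution (f : ℝ → ℝ) (B : ℝ) (x : Plane) : ℝ :=
  tailInverse f (tailIntegral (modelNonlinearity B) (modelSolution B x))

/-- `R₁(x) = |1 / B₁[f](ũ(x)) - 1 / B₁[g](v(x))|`. -/
def R₁ (f : ℝ → ℝ) (B : ℝ) (x : Plane) : ℝ :=
  |invB₁ f (approxSolution f B x) - invB₁ (modelNonlinearity B) (modelSolution B x)|

/-- `R₂(x) = |1 / B₂[f](ũ(x)) - 1 / B₂[g](v(x))|`. -/
def R₂ (f : ℝ → ℝ) (B : ℝ) (x : Plane) : ℝ :=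
  |invB₂ f (approxSolution f B x) - invB₂ (modelNonlinearity B) (modelSolution B x)|

/-- The discrepancy condition `(-log |x|)^{1/2} (R₁(x) + R₂(x)) → 0` as `x → 0`, for a
nonlinearity `f` with growth exponent `B`. -/
def DiscrepancyCondition (f : ℝ → ℝ) (B : ℝ) : Prop :=
  Tendsto (fun x : Plane => (-log ‖x‖) ^ (1 / 2 : ℝ) * (R₁ f B x + R₂ f B x))
    (𝓝[≠] 0) (𝓝 0)

/-- `u` is a nonnegative smooth radial singular solution of `-Δ u = f(u)` in the punctured disc of
radius `R`. -/
structure IsSmoothSingularSolution (f : ℝ → ℝ) (R : ℝ) (u : Plane → ℝ) : Prop where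
  contDiffOn : ContDiffOn ℝ ∞ u (Metric.ball 0 R \ {0})
  nonneg : ∀ x ∈ Metric.ball (0 : Plane) R \ {0}, 0 ≤ u x
  radial : ∀ x ∈ Metric.ball (0 : Plane) R \ {0}, ∀ y ∈ Metric.ball (0 : Plane) R \ {0},
    ‖x‖ = ‖y‖ → u x = u y
  equation : ∀ x ∈ Metric.ball (0 : Plane) R \ {0},
    -(Laplacian.laplacian u x) = f (u x)
  singular : Tendsto u (𝓝[≠] 0) atTop

/-- `w(x) = (1/4) |x|² (log (1 / |x|²) + 1)`. -/
def wFun (x : Plane) : ℝ := 1 / 4 * ‖x‖ ^ 2 * (log (1 / ‖x‖ ^ 2) + 1)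

end SingularSol

end

/-!
Write `f = exp ∘ φ` with `φ(s) = exp (s ^ q)` and let `κ = φ'' / φ' ^ 2`, regarded as a function of
`t = φ(s)`. Integrating `F = ∫ 1 / f` by parts gives `f' F = 1 - κ + κ² - dκ/dt + O(t⁻³)`, so that
`1 / B₁[f]` and `1 / B₂[f]` are, up to `O(log t / t)`, equal to `t κ` and `-t² dκ/dt`. Here
`t κ = 1 + (1 - 1 / q) / log t`: both tend to `1`, but at the rate `(1 - 1 / q) / log t` unless
`q = 1`. At `s = ũ(x)` we have `t ~ L` for `L = log (1 / |x|²)`, and the quantities of the model are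
`1 + O(log L / L)`, so the weight `√L` is beaten exactly when `q = 1`.

For `q = 1` and `u(x) = y(L)` the equation `-Δ u = f(u)` becomes `y'' = -exp (-L + exp y) / 4`,
which `y = log P` with `P = L - 2 log L + 2 log 2 + (4 log L - 4 log 2 - 6) / L` solves up to a
residual `O(log² L / L⁴)`. The linearization at `log P` is close to
`θ'' + (1 / L + 3 / (16 L²)) θ = 0`, whose solutions are exactly the combinations of
`L ^ (1 / 4) cos (2 √L)` and `L ^ (1 / 4) sin (2 √L)`. Variation of constants from infinity maps a
source of size `L ^ (-7 / 2)` to a solution of size `L⁻²`, which makes the problem for the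
correction `θ` a contraction in the norm `sup |L² θ|` and gives `u = log P + O(L⁻²)`.
-/

noncomputable section

namespace SingularSol

section TailIntegral

theorem hasDerivAt_integral_Ioi {E : Type*} [NormedAddCommGroup E] [NormedSpace ℝ E]
    [CompleteSpace E] {h : ℝ → E} {a x : ℝ} (hint : MeasureTheory.IntegrableOn h (Ioi a))
    (hc : ContinuousAt h x) (hx : a < x) :
    HasDerivAt (fun y => ∫ τ in Ioi y, h τ) (-h x) x := by
  obtain ⟨b, hab, hbx⟩ := exists_between hx
  have hb : MeasureTheory.IntegrableOn h (Ioi b) := hint.mono_set (Ioi_subset_Ioi hab.le)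
  have hbx_int : IntervalIntegrable h MeasureTheory.volume b x :=
    (intervalIntegrable_iff_integrableOn_Ioc_of_le hbx.le).2 (hb.mono_set Ioc_subset_Ioi_self)
  have hderiv : HasDerivAt (fun y => ∫ τ in b..y, h τ) (h x) x :=
    intervalIntegral.integral_hasDerivAt_right hbx_int ⟨Ioi a, Ioi_mem_nhds hx, hint.1⟩ hc
  refine (hderiv.const_sub (∫ τ in Ioi b, h τ)).congr_of_eventuallyEq ?_
  filter_upwards [Ioi_mem_nhds hbx] with y hy
  rw [← intervalIntegral.integral_Ioi_sub_Ioi hb (le_of_lt hy), sub_sub_cancel]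

theorem nonneg_of_deriv_nonpos_of_tendsto_zero {P P' : ℝ → ℝ} {a : ℝ}
    (hP : ∀ s, a ≤ s → HasDerivAt P (P' s) s) (hP' : ∀ s, a ≤ s → P' s ≤ 0)
    (hlim : Tendsto P atTop (𝓝 0)) : 0 ≤ P a := by
  have hanti : AntitoneOn P (Ici a) :=
    antitoneOn_of_hasDerivWithinAt_nonpos (convex_Ici a)
      (fun s hs => (hP s hs).continuousAt.continuousWithinAt)
      (fun s hs => (hP s (interior_subset hs)).hasDerivWithinAt)
      (fun s hs => hP' s (interior_subset hs))
  refine le_of_tendsto hlim ?_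
  filter_upwards [eventually_ge_atTop a] with y hy
  exact hanti self_mem_Ici hy hy

theorem abs_le_mul_of_abs_deriv_le {D D' F F' : ℝ → ℝ} {κ a : ℝ}
    (hD : ∀ s, a ≤ s → HasDerivAt D (D' s) s) (hF : ∀ s, a ≤ s → HasDerivAt F (F' s) s)
    (h : ∀ s, a ≤ s → |D' s| ≤ κ * -F' s)
    (hD0 : Tendsto D atTop (𝓝 0)) (hF0 : Tendsto F atTop (𝓝 0)) : |D a| ≤ κ * F a := by
  have hκF : Tendsto (fun s => κ * F s) atTop (𝓝 0) := by simpa using hF0.const_mul κ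
  have hsub := nonneg_of_deriv_nonpos_of_tendsto_zero (P := fun s => κ * F s - D s)
    (fun s hs => ((hF s hs).const_mul κ).sub (hD s hs))
    (fun s hs => by linarith [(abs_le.1 (h s hs)).1]) (by simpa using hκF.sub hD0)
  have hadd := nonneg_of_deriv_nonpos_of_tendsto_zero (P := fun s => κ * F s + D s)
    (fun s hs => ((hF s hs).const_mul κ).add (hD s hs))
    (fun s hs => by linarith [(abs_le.1 (h s hs)).2]) (by simpa using hκF.add hD0)
  exact abs_le.2 ⟨by linarith, by linarith⟩

theorem isBigO_mul_of_deriv_isBigO {D D' F F' g : ℝ → ℝ} {a : ℝ}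
    (hD : ∀ᶠ s in atTop, HasDerivAt D (D' s) s) (hF : ∀ᶠ s in atTop, HasDerivAt F (F' s) s)
    (hF' : ∀ᶠ s in atTop, F' s ≤ 0) (hg : AntitoneOn g (Ici a)) (hg0 : ∀ᶠ s in atTop, 0 ≤ g s)
    (h : D' =O[atTop] fun s => g s * F' s)
    (hD0 : Tendsto D atTop (𝓝 0)) (hF0 : Tendsto F atTop (𝓝 0)) :
    D =O[atTop] fun s => g s * F s := by
  obtain ⟨C, hC0, hC⟩ := h.exists_pos
  refine IsBigO.of_bound C ?_
  filter_upwards [eventually_forall_ge_atTop.2 hD, eventually_forall_ge_atTop.2 hF,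
    eventually_forall_ge_atTop.2 hF', eventually_forall_ge_atTop.2 hg0,
    eventually_forall_ge_atTop.2 hC.bound, eventually_ge_atTop a] with s hDs hFs hF's hgs hCs has
  refine (abs_le_mul_of_abs_deriv_le (κ := C * g s) hDs hFs (fun y hy => ?_) hD0 hF0).trans ?_
  · calc |D' y| ≤ C * |g y * F' y| := hCs y hy
      _ = C * g y * -F' y := by
        rw [abs_mul, abs_of_nonneg (hgs y hy), abs_of_nonpos (hF's y hy), mul_assoc]
      _ ≤ C * g s * -F' y := mul_le_mul_of_nonneg_right
        (mul_le_mul_of_nonneg_left (hg has (le_trans has hy) hy) hC0.le)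
        (neg_nonneg.2 (hF's y hy))
  · rw [mul_assoc]
    exact mul_le_mul_of_nonneg_left (le_abs_self _) hC0.le

theorem tendsto_tailIntegral (f : ℝ → ℝ) : Tendsto (tailIntegral f) atTop (𝓝 0) :=
  MeasureTheory.tendsto_integral_Ioi_zero tendsto_id

/-- The nonlinearities for which `F = tailIntegral f` is a decreasing bijection of `(0, ∞)` onto
its range and `F' = -1 / f`: positive and continuous, with `1 / f` integrable on `(0, ∞)`. -/
structure TailIntegrable (f : ℝ → ℝ) : Prop where
  continuousOn : ContinuousOn f (Ioi 0)
  pos : ∀ s ∈ Ioi (0 : ℝ), 0 < f s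
  integrableOn : MeasureTheory.IntegrableOn (fun τ => 1 / f τ) (Ioi 0)

namespace TailIntegrable

variable {f : ℝ → ℝ} {s w : ℝ}

theorem hasDerivAt_tailIntegral (hf : TailIntegrable f) (hs : 0 < s) :
    HasDerivAt (tailIntegral f) (-(1 / f s)) s :=
  hasDerivAt_integral_Ioi hf.integrableOn (continuousAt_const.div
    (hf.continuousOn.continuousAt (Ioi_mem_nhds hs)) (hf.pos s hs).ne') hs

theorem tailIntegral_continuousOn (hf : TailIntegrable f) :
    ContinuousOn (tailIntegral f) (Ioi 0) :=
  fun _ hs => (hf.hasDerivAt_tailIntegral hs).continuousAt.continuousWithinAt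

theorem tailIntegral_strictAntiOn (hf : TailIntegrable f) :
    StrictAntiOn (tailIntegral f) (Ioi 0) := by
  refine strictAntiOn_of_deriv_neg (convex_Ioi 0) hf.tailIntegral_continuousOn fun s hs => ?_
  rw [interior_Ioi] at hs
  rw [(hf.hasDerivAt_tailIntegral hs).deriv]
  exact neg_neg_of_pos (one_div_pos.2 (hf.pos s hs))

theorem tailIntegral_pos (hf : TailIntegrable f) (hs : 0 < s) : 0 < tailIntegral f s := by
  have hs1 : 0 < s + 1 := by linarith
  have hlt : tailIntegral f (s + 1) < tailIntegral f s :=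
    hf.tailIntegral_strictAntiOn hs hs1 (lt_add_one s)
  refine (nonneg_of_deriv_nonpos_of_tendsto_zero
    (fun y hy => hf.hasDerivAt_tailIntegral (hs1.trans_le hy))
    (fun y hy => ?_) (tendsto_tailIntegral f)).trans_lt hlt
  exact neg_nonpos.2 (one_div_pos.2 (hf.pos y (hs1.trans_le hy))).le

theorem tailInverse_spec (hf : TailIntegrable f) (hw : 0 < w) (hw1 : w ≤ tailIntegral f 1) :
    0 < tailInverse f w ∧ tailIntegral f (tailInverse f w) = w := by
  obtain ⟨b, hb, hb1⟩ := (((tendsto_tailIntegral f).eventually (gt_mem_nhds hw)).and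
    (eventually_ge_atTop 1)).exists
  have hcont : ContinuousOn (tailIntegral f) (Icc 1 b) :=
    hf.tailIntegral_continuousOn.mono fun y hy => one_pos.trans_le hy.1
  obtain ⟨s, hs, hsw⟩ := intermediate_value_Icc' hb1 hcont ⟨hb.le, hw1⟩
  have hex : ∃ s ∈ Ioi (0 : ℝ), tailIntegral f s = w := ⟨s, one_pos.trans_le hs.1, hsw⟩
  exact ⟨Function.invFunOn_mem hex, Function.invFunOn_eq hex⟩

theorem eventually_tailInverse_spec (hf : TailIntegrable f) :
    ∀ᶠ w in 𝓝[>] 0, 0 < tailInverse f w ∧ tailIntegral f (tailInverse f w) = w := by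
  filter_upwards [Ioo_mem_nhdsGT (hf.tailIntegral_pos one_pos)] with w hw
  exact hf.tailInverse_spec hw.1 hw.2.le

theorem tendsto_tailInverse (hf : TailIntegrable f) :
    Tendsto (tailInverse f) (𝓝[>] 0) atTop := by
  refine tendsto_atTop.2 fun M => ?_
  have hM : 0 < max M 1 := lt_max_of_lt_right one_pos
  filter_upwards [Ioo_mem_nhdsGT (hf.tailIntegral_pos hM), hf.eventually_tailInverse_spec]
    with w hw ⟨hpos, heq⟩
  by_contra! hlt
  have := hf.tailIntegral_strictAntiOn hpos hM (lt_max_of_lt_left hlt)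
  rw [heq] at this
  exact lt_asymm this hw.2

end TailIntegrable

end TailIntegral

section ExponentialPhase

theorem isBigO_mul_of_isBigO_one {α : Type*} {l : Filter α} {X Y e : α → ℝ} (hX : X =O[l] e)
    (hY : Y =O[l] fun _ => (1 : ℝ)) : (fun s => X s * Y s) =O[l] e := by
  simpa only [mul_one] using hX.mul hY

theorem isBigO_mul_sub_mul {α : Type*} {l : Filter α} {X x Y y e : α → ℝ}
    (hX : (fun s => X s - x s) =O[l] e) (hY : (fun s => Y s - y s) =O[l] e)
    (hx : x =O[l] (fun _ => (1 : ℝ))) (hy : y =O[l] (fun _ => (1 : ℝ)))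
    (he : e =O[l] (fun _ => (1 : ℝ))) :
    (fun s => X s * Y s - x s * y s) =O[l] e := by
  have hY1 : Y =O[l] (fun _ => (1 : ℝ)) := by simpa using (hY.trans he).add hy
  exact ((isBigO_mul_of_isBigO_one hX hY1).add (isBigO_mul_of_isBigO_one hY hx)).congr_left
    fun s => by ring

/-- The product `f' F`, whose deviation from `1` is measured by `invB₁` and `invB₂`. -/
def derivTail (f : ℝ → ℝ) (s : ℝ) : ℝ := deriv f s * tailIntegral f s

/-- A phase `φ` of a rapidly growing nonlinearity `f = exp ∘ φ`. The curvature `φ'' / φ' ^ 2` is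
encoded as a function `κ` of the value of `φ`, with derivatives `κ₁` and `κ₂`; it and its
derivatives decay like `1 / t` and its derivatives. -/
structure IsSlowPhase (φ φ' κ κ₁ κ₂ : ℝ → ℝ) : Prop where
  tailIntegrable : TailIntegrable (exp ∘ φ)
  tendsto : Tendsto φ atTop atTop
  deriv_pos : ∀ s, 0 < s → 0 < φ' s
  hasDerivAt : ∀ s, 0 < s → HasDerivAt φ (φ' s) s
  hasDerivAt_deriv : ∀ s, 0 < s → HasDerivAt φ' (φ' s ^ 2 * κ (φ s)) s
  log_deriv_isLittleO : (fun s => log (φ' s)) =o[atTop] φ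
  hasDerivAt_curvature : ∀ᶠ t in atTop, HasDerivAt κ (κ₁ t) t
  hasDerivAt_curvature_deriv : ∀ᶠ t in atTop, HasDerivAt κ₁ (κ₂ t) t
  curvature_isBigO : κ =O[atTop] fun t => t⁻¹
  curvature_deriv_isBigO : κ₁ =O[atTop] fun t => t⁻¹ ^ 2
  curvature_deriv₂_isBigO : κ₂ =O[atTop] fun t => t⁻¹ ^ 3

/-- The second order approximation of `f' F` for `f = exp ∘ φ`, found by integrating
`∫ 1 / f` by parts, as a function of `t = φ(s)`. -/
def derivTailApprox (κ κ₁ : ℝ → ℝ) (t : ℝ) : ℝ := 1 - κ t + κ t ^ 2 - κ₁ t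

/-- The error made by `derivTailApprox` in the equation `(f' F / f')' = -1 / f`. -/
def derivTailDefect (κ κ₁ κ₂ : ℝ → ℝ) (t : ℝ) : ℝ := κ t ^ 3 - 3 * κ t * κ₁ t + κ₂ t

/-- The order of the error in the expansions of `invB₁ (exp ∘ φ)` and `invB₂ (exp ∘ φ)`; the
logarithm comes from `log f' = φ + log φ'`. -/
def phaseError (φ φ' : ℝ → ℝ) (s : ℝ) : ℝ := (1 + |log (φ' s)|) * (φ s)⁻¹

theorem inv_isBigO_phaseError (φ φ' : ℝ → ℝ) :
    (fun s => (φ s)⁻¹) =O[atTop] phaseError φ φ' := by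
  refine IsBigO.of_bound' (Eventually.of_forall fun s => ?_)
  rw [phaseError, norm_mul, norm_of_nonneg (r := 1 + |log (φ' s)|) (by positivity)]
  exact le_mul_of_one_le_left (norm_nonneg _) (by simp)

namespace IsSlowPhase

variable {φ φ' κ κ₁ κ₂ : ℝ → ℝ} (h : IsSlowPhase φ φ' κ κ₁ κ₂) {s : ℝ}

include h

theorem monotoneOn : MonotoneOn φ (Ioi 0) :=
  monotoneOn_of_hasDerivWithinAt_nonneg (convex_Ioi 0)
    (fun s hs => (h.hasDerivAt s hs).continuousAt.continuousWithinAt)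
    (fun s hs => (h.hasDerivAt s (interior_subset hs)).hasDerivWithinAt)
    (fun s hs => (h.deriv_pos s (interior_subset hs)).le)

theorem deriv_exp_comp (hs : 0 < s) : deriv (exp ∘ φ) s = exp (φ s) * φ' s :=
  (h.hasDerivAt s hs).exp.deriv

theorem deriv_exp_comp_pos (hs : 0 < s) : 0 < deriv (exp ∘ φ) s := by
  rw [h.deriv_exp_comp hs]
  exact mul_pos (exp_pos _) (h.deriv_pos s hs)

theorem hasDerivAt_deriv_exp_comp (hs : 0 < s) :
    HasDerivAt (deriv (exp ∘ φ)) (exp (φ s) * φ' s ^ 2 * (1 + κ (φ s))) s := by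
  have hprod := (h.hasDerivAt s hs).exp.mul (h.hasDerivAt_deriv s hs)
  refine (hprod.congr_of_eventuallyEq ?_).congr_deriv (by ring)
  filter_upwards [Ioi_mem_nhds hs] with y hy using h.deriv_exp_comp hy

theorem hasDerivAt_derivTailApprox_div : ∀ᶠ s in atTop,
    HasDerivAt (fun y => derivTailApprox κ κ₁ (φ y) / deriv (exp ∘ φ) y)
      (-(1 / exp (φ s)) * (1 + derivTailDefect κ κ₁ κ₂ (φ s))) s := by
  filter_upwards [eventually_gt_atTop 0, h.tendsto.eventually h.hasDerivAt_curvature,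
    h.tendsto.eventually h.hasDerivAt_curvature_deriv] with s hs hκ hκ₁
  have happrox : HasDerivAt (derivTailApprox κ κ₁)
      (-κ₁ (φ s) + 2 * κ (φ s) * κ₁ (φ s) - κ₂ (φ s)) (φ s) :=
    (((hκ.const_sub 1).add (hκ.pow 2)).sub hκ₁).congr_deriv (by simp)
  refine ((happrox.comp s (h.hasDerivAt s hs)).div (h.hasDerivAt_deriv_exp_comp hs)
    (h.deriv_exp_comp_pos hs).ne').congr_deriv ?_
  have hφ' := h.deriv_pos s hs
  simp only [Function.comp, h.deriv_exp_comp hs, derivTailDefect, derivTailApprox]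
  field_simp
  ring

theorem tendsto_inv : Tendsto (fun s => (φ s)⁻¹) atTop (𝓝 0) := h.tendsto.inv_tendsto_atTop

theorem inv_isBigO_one : (fun s => (φ s)⁻¹) =O[atTop] fun _ => (1 : ℝ) :=
  h.tendsto_inv.isBigO_one ℝ

theorem inv_sq_isBigO_inv : (fun s => (φ s)⁻¹ ^ 2) =O[atTop] fun s => (φ s)⁻¹ := by
  simpa [sq] using h.inv_isBigO_one.mul (isBigO_refl (fun s => (φ s)⁻¹) atTop)

theorem curvature_comp_isBigO : (fun s => κ (φ s)) =O[atTop] fun s => (φ s)⁻¹ :=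
  h.curvature_isBigO.comp_tendsto h.tendsto

theorem curvature_deriv_comp_isBigO : (fun s => κ₁ (φ s)) =O[atTop] fun s => (φ s)⁻¹ ^ 2 :=
  h.curvature_deriv_isBigO.comp_tendsto h.tendsto

theorem derivTailDefect_isBigO :
    (fun s => derivTailDefect κ κ₁ κ₂ (φ s)) =O[atTop] fun s => (φ s)⁻¹ ^ 3 := by
  have hmul : (fun s => κ (φ s) * κ₁ (φ s)) =O[atTop] fun s => (φ s)⁻¹ ^ 3 :=
    (h.curvature_comp_isBigO.mul h.curvature_deriv_comp_isBigO).congr_right fun s => by ring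
  exact (((h.curvature_comp_isBigO.pow 3).sub (hmul.const_mul_left 3)).add
    (h.curvature_deriv₂_isBigO.comp_tendsto h.tendsto)).congr_left fun s => by
      simp only [derivTailDefect, Function.comp]; ring

theorem derivTailApprox_sub_isBigO :
    (fun s => derivTailApprox κ κ₁ (φ s) - (1 - κ (φ s))) =O[atTop] fun s => (φ s)⁻¹ ^ 2 :=
  ((h.curvature_comp_isBigO.pow 2).sub h.curvature_deriv_comp_isBigO).congr_left fun s => by
    rw [derivTailApprox]; ring

theorem derivTailApprox_sub_one_isBigO :
    (fun s => derivTailApprox κ κ₁ (φ s) - 1) =O[atTop] fun s => (φ s)⁻¹ :=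
  ((h.derivTailApprox_sub_isBigO.trans h.inv_sq_isBigO_inv).sub
    h.curvature_comp_isBigO).congr_left fun s => by ring

theorem tendsto_derivTailApprox : Tendsto (fun s => derivTailApprox κ κ₁ (φ s)) atTop (𝓝 1) := by
  simpa using (h.derivTailApprox_sub_one_isBigO.trans_tendsto h.tendsto_inv).add_const 1

theorem tendsto_deriv_exp_comp : Tendsto (deriv (exp ∘ φ)) atTop atTop := by
  have hsum : Tendsto (fun s => φ s + log (φ' s)) atTop atTop :=
    (IsEquivalent.refl.add_isLittleO h.log_deriv_isLittleO).symm.tendsto_atTop h.tendsto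
  refine (tendsto_exp_atTop.comp hsum).congr' ?_
  filter_upwards [eventually_gt_atTop 0] with s hs
  rw [Function.comp_apply, exp_add, exp_log (h.deriv_pos s hs), h.deriv_exp_comp hs]

theorem derivTail_sub_approx_isBigO_mul :
    (fun s => derivTail (exp ∘ φ) s - derivTailApprox κ κ₁ (φ s)) =O[atTop]
      fun s => (φ s)⁻¹ ^ 3 * derivTail (exp ∘ φ) s := by
  obtain ⟨s₀, hs₀, hφ₀⟩ :=
    ((eventually_gt_atTop 0).and
      (eventually_forall_ge_atTop.2 (h.tendsto.eventually_gt_atTop 0))).exists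
  have hanti : AntitoneOn (fun s => (φ s)⁻¹ ^ 3) (Ici s₀) := fun x hx y hy hxy =>
    pow_le_pow_left₀ (inv_nonneg.2 (hφ₀ y hy).le) (inv_anti₀ (hφ₀ x hx)
      (h.monotoneOn (hs₀.trans_le hx) (hs₀.trans_le hy) hxy)) 3
  have hF : ∀ᶠ s in atTop, HasDerivAt (tailIntegral (exp ∘ φ)) (-(1 / exp (φ s))) s := by
    filter_upwards [eventually_gt_atTop 0] with s hs
      using h.tailIntegrable.hasDerivAt_tailIntegral hs
  have hF0 := tendsto_tailIntegral (exp ∘ φ)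
  have hdiff : (fun s => tailIntegral (exp ∘ φ) s - derivTailApprox κ κ₁ (φ s) /
      deriv (exp ∘ φ) s) =O[atTop] fun s => (φ s)⁻¹ ^ 3 * tailIntegral (exp ∘ φ) s := by
    refine isBigO_mul_of_deriv_isBigO (D' := fun s =>
      -(derivTailDefect κ κ₁ κ₂ (φ s) * -(1 / exp (φ s)))) ?_ hF
      (Eventually.of_forall fun s => neg_nonpos.2 (one_div_pos.2 (exp_pos _)).le) hanti ?_
      (h.derivTailDefect_isBigO.mul (isBigO_refl _ _)).neg_left ?_ hF0
    · filter_upwards [hF, h.hasDerivAt_derivTailApprox_div] with s hFs hPs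
      exact (hFs.sub hPs).congr_deriv (by ring)
    · filter_upwards [h.tendsto.eventually_gt_atTop 0] with s hs
      positivity
    · simpa using hF0.sub (h.tendsto_derivTailApprox.div_atTop h.tendsto_deriv_exp_comp)
  refine (hdiff.mul (isBigO_refl (deriv (exp ∘ φ)) atTop)).congr' ?_ ?_
  · filter_upwards [eventually_gt_atTop 0] with s hs
    rw [sub_mul, div_mul_cancel₀ _ (h.deriv_exp_comp_pos hs).ne', derivTail, mul_comm]
  · exact Eventually.of_forall fun s => by simp only [derivTail]; ring

theorem derivTail_isBigO_one : derivTail (exp ∘ φ) =O[atTop] fun _ => (1 : ℝ) := by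
  have hsmall : (fun s => (φ s)⁻¹ ^ 3 * derivTail (exp ∘ φ) s) =o[atTop] derivTail (exp ∘ φ) := by
    have hinv : (fun s => (φ s)⁻¹ ^ 3) =o[atTop] fun _ => (1 : ℝ) :=
      (isLittleO_one_iff ℝ).2 (by simpa using h.tendsto_inv.pow 3)
    simpa using hinv.mul_isBigO (isBigO_refl (derivTail (exp ∘ φ)) atTop)
  have hequiv : (fun s => derivTailApprox κ κ₁ (φ s)) ~[atTop] derivTail (exp ∘ φ) :=
    (h.derivTail_sub_approx_isBigO_mul.trans_isLittleO hsmall).neg_left.congr_left fun s => by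
      simp
  exact hequiv.symm.isBigO.trans (h.tendsto_derivTailApprox.isBigO_one ℝ)

theorem derivTail_sub_approx_isBigO :
    (fun s => derivTail (exp ∘ φ) s - derivTailApprox κ κ₁ (φ s)) =O[atTop]
      fun s => (φ s)⁻¹ ^ 3 := by
  simpa using h.derivTail_sub_approx_isBigO_mul.trans
    ((isBigO_refl (fun s => (φ s)⁻¹ ^ 3) atTop).mul h.derivTail_isBigO_one)

theorem mul_one_sub_derivTail_isBigO :
    (fun s => φ s * (1 - derivTail (exp ∘ φ) s) - φ s * κ (φ s)) =O[atTop]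
      fun s => (φ s)⁻¹ := by
  have hcube : (fun s => (φ s)⁻¹ ^ 3) =O[atTop] fun s => (φ s)⁻¹ ^ 2 :=
    (h.inv_isBigO_one.mul (isBigO_refl (fun s => (φ s)⁻¹ ^ 2) atTop)).congr
      (fun s => by ring) fun s => one_mul _
  have hsum := (h.derivTail_sub_approx_isBigO.trans hcube).add h.derivTailApprox_sub_isBigO
  refine ((isBigO_refl φ atTop).mul hsum.neg_left).congr' (Eventually.of_forall fun s => ?_) ?_
  · ring
  · filter_upwards [h.tendsto.eventually_ne_atTop 0] with s hs
    field_simp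

theorem sq_mul_derivTail_mul_isBigO :
    (fun s => φ s ^ 2 * (derivTail (exp ∘ φ) s * (1 + κ (φ s)) - 1) - -(φ s ^ 2 * κ₁ (φ s)))
      =O[atTop] fun s => (φ s)⁻¹ := by
  have hcurv : (fun s => 1 + κ (φ s)) =O[atTop] fun _ => (1 : ℝ) :=
    (isBigO_refl _ _).add (h.curvature_comp_isBigO.trans h.inv_isBigO_one)
  have hmul : (fun s => κ (φ s) * κ₁ (φ s)) =O[atTop] fun s => (φ s)⁻¹ ^ 3 :=
    (h.curvature_comp_isBigO.mul h.curvature_deriv_comp_isBigO).congr_right fun s => by ring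
  have hsum := ((hcurv.mul h.derivTail_sub_approx_isBigO).congr_right fun s => one_mul _).add
    ((h.curvature_comp_isBigO.pow 3).sub hmul)
  refine ((isBigO_refl (fun s => φ s ^ 2) atTop).mul hsum).congr'
    (Eventually.of_forall fun s => ?_) ?_
  · simp only [derivTailApprox]
    ring
  · filter_upwards [h.tendsto.eventually_ne_atTop 0] with s hs
    field_simp

theorem derivTail_sub_one_isBigO :
    (fun s => derivTail (exp ∘ φ) s - 1) =O[atTop] fun s => (φ s)⁻¹ := by
  have hcube : (fun s => (φ s)⁻¹ ^ 3) =O[atTop] fun s => (φ s)⁻¹ := by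
    simpa [pow_succ] using (h.inv_isBigO_one.mul h.inv_isBigO_one).mul
      (isBigO_refl (fun s => (φ s)⁻¹) atTop)
  exact ((h.derivTail_sub_approx_isBigO.trans hcube).add
    h.derivTailApprox_sub_one_isBigO).congr_left fun s => by ring

theorem tendsto_derivTail : Tendsto (derivTail (exp ∘ φ)) atTop (𝓝 1) := by
  simpa using (h.derivTail_sub_one_isBigO.trans_tendsto h.tendsto_inv).add_const 1

theorem neg_log_tailIntegral_eq (hs : 0 < s) : -log (tailIntegral (exp ∘ φ) s) =
    φ s + (log (φ' s) - log (derivTail (exp ∘ φ) s)) := by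
  rw [derivTail, log_mul (h.deriv_exp_comp_pos hs).ne' (h.tailIntegrable.tailIntegral_pos hs).ne',
    h.deriv_exp_comp hs, log_mul (exp_pos _).ne' (h.deriv_pos s hs).ne', log_exp]
  ring

theorem neg_log_tailIntegral_div_isBigO :
    (fun s => -log (tailIntegral (exp ∘ φ) s) / φ s - 1) =O[atTop]
      phaseError φ φ' := by
  have hlog : (fun s => log (derivTail (exp ∘ φ) s)) =O[atTop] fun _ => (1 : ℝ) :=
    (h.tendsto_derivTail.log one_ne_zero).isBigO_one ℝ
  have hnum : (fun s => log (φ' s) - log (derivTail (exp ∘ φ) s)) =O[atTop]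
      fun s => 1 + |log (φ' s)| := by
    obtain ⟨C, hC⟩ := hlog.bound
    refine IsBigO.of_bound (1 + |C|) ?_
    filter_upwards [hC] with s hs
    rw [norm_one, mul_one] at hs
    rw [norm_of_nonneg (r := 1 + |log (φ' s)|) (by positivity)]
    refine (norm_sub_le _ _).trans ?_
    simp only [norm_eq_abs] at hs ⊢
    nlinarith [le_abs_self C, abs_nonneg C, abs_nonneg (log (φ' s))]
  refine (hnum.mul (isBigO_refl (fun s => (φ s)⁻¹) atTop)).congr'
    ?_ EventuallyEq.rfl
  filter_upwards [eventually_gt_atTop 0, h.tendsto.eventually_ne_atTop 0] with s hs hφ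
  rw [h.neg_log_tailIntegral_eq hs]
  field_simp
  ring

theorem tendsto_phaseError : Tendsto (phaseError φ φ') atTop (𝓝 0) := by
  have hlog : Tendsto (fun s => |log (φ' s)| * (φ s)⁻¹) atTop (𝓝 0) := by
    refine (h.log_deriv_isLittleO.abs_left.tendsto_div_nhds_zero).congr fun s => ?_
    rw [div_eq_mul_inv]
  have hsum := h.tendsto_inv.add hlog
  rw [add_zero] at hsum
  exact hsum.congr fun s => by rw [phaseError]; ring

theorem mul_curvature_isBigO_one : (fun s => φ s * κ (φ s)) =O[atTop] fun _ => (1 : ℝ) := by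
  refine ((isBigO_refl φ atTop).mul h.curvature_comp_isBigO).congr' EventuallyEq.rfl ?_
  filter_upwards [h.tendsto.eventually_ne_atTop 0] with s hs using mul_inv_cancel₀ hs

theorem sq_mul_curvature_deriv_isBigO_one :
    (fun s => -(φ s ^ 2 * κ₁ (φ s))) =O[atTop] fun _ => (1 : ℝ) := by
  refine ((isBigO_refl (fun s => φ s ^ 2) atTop).mul
    h.curvature_deriv_comp_isBigO).neg_left.congr' EventuallyEq.rfl ?_
  filter_upwards [h.tendsto.eventually_ne_atTop 0] with s hs
  field_simp

theorem invB₁_sub_isBigO :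
    (fun s => invB₁ (exp ∘ φ) s - φ s * κ (φ s)) =O[atTop]
      phaseError φ φ' := by
  refine (isBigO_mul_sub_mul h.neg_log_tailIntegral_div_isBigO
    (h.mul_one_sub_derivTail_isBigO.trans (inv_isBigO_phaseError φ φ'))
    (isBigO_refl _ _) h.mul_curvature_isBigO_one
    (h.tendsto_phaseError.isBigO_one ℝ)).congr' ?_ EventuallyEq.rfl
  filter_upwards [h.tendsto.eventually_ne_atTop 0] with s hs
  rw [invB₁, ← derivTail]
  field_simp

theorem invB₂_sub_isBigO :
    (fun s => invB₂ (exp ∘ φ) s - -(φ s ^ 2 * κ₁ (φ s))) =O[atTop]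
      phaseError φ φ' := by
  have hη := h.tendsto_phaseError.isBigO_one ℝ
  have hinv := inv_isBigO_phaseError φ φ'
  have hlog := h.neg_log_tailIntegral_div_isBigO
  have hone := isBigO_refl (fun _ : ℝ => (1 : ℝ)) atTop
  have hlog_sq : (fun s => (-log (tailIntegral (exp ∘ φ) s) / φ s) *
      (-log (tailIntegral (exp ∘ φ) s) / φ s) - 1) =O[atTop] phaseError φ φ' := by
    simpa using isBigO_mul_sub_mul hlog hlog hone hone hη
  have hprefactor : (fun s => derivTail (exp ∘ φ) s * ((-log (tailIntegral (exp ∘ φ) s) / φ s) *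
      (-log (tailIntegral (exp ∘ φ) s) / φ s)) - 1) =O[atTop] phaseError φ φ' := by
    simpa using isBigO_mul_sub_mul (h.derivTail_sub_one_isBigO.trans hinv) hlog_sq hone hone hη
  refine (isBigO_mul_sub_mul hprefactor (h.sq_mul_derivTail_mul_isBigO.trans hinv) hone
    h.sq_mul_curvature_deriv_isBigO_one hη).congr' ?_ EventuallyEq.rfl
  filter_upwards [eventually_gt_atTop 0, h.tendsto.eventually_ne_atTop 0] with s hs hφ
  have hφ' := h.deriv_pos s hs
  have hsecond : (exp ∘ φ) s * deriv (deriv (exp ∘ φ)) s * tailIntegral (exp ∘ φ) s /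
      deriv (exp ∘ φ) s = derivTail (exp ∘ φ) s * (1 + κ (φ s)) := by
    rw [(h.hasDerivAt_deriv_exp_comp hs).deriv, derivTail, h.deriv_exp_comp hs]
    simp only [Function.comp]
    field_simp
  rw [invB₂, hsecond, ← derivTail]
  field_simp

end IsSlowPhase

end ExponentialPhase

section DoubleExp

variable {q : ℝ}

theorem tendsto_exp_rpow (hq : 0 < q) : Tendsto (fun s : ℝ => exp (s ^ q)) atTop atTop :=
  tendsto_exp_atTop.comp (tendsto_rpow_atTop hq)

theorem doubleExp_pos (q s : ℝ) : 0 < doubleExp q s := exp_pos _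

theorem continuous_doubleExp (hq : 0 ≤ q) : Continuous (doubleExp q) :=
  continuous_exp.comp (continuous_exp.comp (continuous_rpow_const hq))

theorem eventually_le_exp_rpow (hq : 0 < q) : ∀ᶠ s : ℝ in atTop, s ≤ exp (s ^ q) := by
  filter_upwards [(isLittleO_log_rpow_atTop hq).bound one_pos, eventually_gt_atTop 0] with s hlog hs
  rw [one_mul, norm_of_nonneg (rpow_nonneg hs.le q)] at hlog
  rw [← log_le_iff_le_exp hs]
  exact (le_abs_self _).trans hlog

theorem tailIntegrable_doubleExp (hq : 0 < q) : TailIntegrable (doubleExp q) where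
  continuousOn := (continuous_doubleExp hq.le).continuousOn
  pos s _ := doubleExp_pos q s
  integrableOn := by
    refine integrable_of_isBigO_exp_neg (b := 1) one_pos (continuous_const.div
      (continuous_doubleExp hq.le) fun s => (doubleExp_pos q s).ne').continuousOn ?_
    refine IsBigO.of_bound' ?_
    filter_upwards [eventually_le_exp_rpow hq] with s hs
    rw [norm_of_nonneg (one_div_pos.2 (doubleExp_pos q s)).le, norm_of_nonneg (exp_pos _).le,
      doubleExp, one_div, ← exp_neg, exp_le_exp]
    linarith

/-- The derivative of the phase `exp (s ^ q)` of `doubleExp q`. -/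
def expRpowDeriv (q s : ℝ) : ℝ := q * s ^ (q - 1) * exp (s ^ q)

/-- The curvature `φ'' / φ' ^ 2` of the phase `φ(s) = exp (s ^ q)` as a function of `t = φ(s)`,
where `a = 1 - 1 / q`. -/
def expRpowCurvature (a t : ℝ) : ℝ := t⁻¹ * (1 + a * (log t)⁻¹)

/-- The derivative of `expRpowCurvature a`. -/
def expRpowCurvatureDeriv (a t : ℝ) : ℝ := -t⁻¹ ^ 2 * (1 + a * (log t)⁻¹ + a * (log t)⁻¹ ^ 2)

/-- The second derivative of `expRpowCurvature a`. -/
def expRpowCurvatureDeriv₂ (a t : ℝ) : ℝ :=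
  t⁻¹ ^ 3 * (2 + 2 * a * (log t)⁻¹ + 3 * a * (log t)⁻¹ ^ 2 + 2 * a * (log t)⁻¹ ^ 3)

theorem hasDerivAt_exp_rpow {s : ℝ} (hs : 0 < s) :
    HasDerivAt (fun y => exp (y ^ q)) (expRpowDeriv q s) s :=
  (hasDerivAt_rpow_const (p := q) (Or.inl hs.ne')).exp.congr_deriv (by rw [expRpowDeriv]; ring)

theorem expRpowDeriv_pos (hq : 0 < q) {s : ℝ} (hs : 0 < s) : 0 < expRpowDeriv q s :=
  mul_pos (mul_pos hq (rpow_pos_of_pos hs _)) (exp_pos _)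

theorem hasDerivAt_expRpowDeriv (hq : q ≠ 0) {s : ℝ} (hs : 0 < s) :
    HasDerivAt (expRpowDeriv q)
      (expRpowDeriv q s ^ 2 * expRpowCurvature (1 - 1 / q) (exp (s ^ q))) s := by
  have hprod := ((hasDerivAt_rpow_const (p := q - 1) (Or.inl hs.ne')).const_mul q).mul
    (hasDerivAt_exp_rpow (q := q) hs)
  refine hprod.congr_deriv ?_
  have := rpow_pos_of_pos hs q
  have := exp_pos (s ^ q)
  rw [expRpowCurvature, log_exp, expRpowDeriv, rpow_sub_one hs.ne' (q - 1), rpow_sub_one hs.ne' q]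
  field_simp
  ring

section Curvature

variable {a t : ℝ}

theorem hasDerivAt_inv_log (ht : 1 < t) :
    HasDerivAt (fun y => (log y)⁻¹) (-(t⁻¹ * (log t)⁻¹ ^ 2)) t :=
  ((hasDerivAt_log (by linarith)).inv (log_pos ht).ne').congr_deriv (by
    rw [neg_div, div_eq_mul_inv, inv_pow])

theorem hasDerivAt_expRpowCurvature (ht : 1 < t) :
    HasDerivAt (expRpowCurvature a) (expRpowCurvatureDeriv a t) t := by
  have hinv := hasDerivAt_inv (show t ≠ 0 by linarith)
  refine (hinv.mul (((hasDerivAt_inv_log ht).const_mul a).const_add 1)).congr_deriv ?_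
  simp only [expRpowCurvatureDeriv, inv_pow]
  ring

theorem hasDerivAt_expRpowCurvatureDeriv (ht : 1 < t) :
    HasDerivAt (expRpowCurvatureDeriv a) (expRpowCurvatureDeriv₂ a t) t := by
  have hinv := hasDerivAt_inv (show t ≠ 0 by linarith)
  have hlog := hasDerivAt_inv_log ht
  refine ((hinv.pow 2).neg.mul (((hlog.const_mul a).const_add 1).add
    ((hlog.pow 2).const_mul a))).congr_deriv ?_
  simp only [expRpowCurvatureDeriv₂, inv_pow, Pi.pow_apply, Pi.neg_apply, Pi.add_apply]
  ring

theorem isBigO_mul_of_tendsto {α : Type*} {l : Filter α} {f g : α → ℝ} {c : ℝ}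
    (hg : Tendsto g l (𝓝 c)) : (fun x => f x * g x) =O[l] f :=
  isBigO_mul_of_isBigO_one (isBigO_refl f l) (hg.isBigO_one ℝ)

theorem tendsto_const_mul_inv_log_pow (c : ℝ) {n : ℕ} (hn : n ≠ 0) :
    Tendsto (fun t : ℝ => c * (log t)⁻¹ ^ n) atTop (𝓝 0) := by
  simpa [hn] using (tendsto_log_atTop.inv_tendsto_atTop.pow n).const_mul c

end Curvature

theorem rpow_isLittleO_exp_rpow (hq : 0 < q) :
    (fun s : ℝ => s ^ q) =o[atTop] fun s => exp (s ^ q) := by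
  simpa [Function.comp_def] using
    (isLittleO_pow_exp_atTop (n := 1)).comp_tendsto (tendsto_rpow_atTop hq)

theorem const_isBigO_rpow (hq : 0 < q) (c : ℝ) :
    (fun _ : ℝ => c) =O[atTop] fun s : ℝ => s ^ q :=
  (isLittleO_const_left.2 (Or.inr
    (tendsto_norm_atTop_atTop.comp (tendsto_rpow_atTop hq)))).isBigO

theorem log_expRpowDeriv_isBigO (hq : 0 < q) :
    (fun s => log (expRpowDeriv q s)) =O[atTop] fun s : ℝ => s ^ q := by
  have hconst := const_isBigO_rpow hq (log q)
  have hlog := (isLittleO_log_rpow_atTop hq).isBigO.const_mul_left (q - 1)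
  refine ((hconst.add hlog).add (isBigO_refl _ _)).congr' ?_ EventuallyEq.rfl
  filter_upwards [eventually_gt_atTop 0] with s hs
  have hpow := (rpow_pos_of_pos hs (q - 1)).ne'
  rw [expRpowDeriv, log_mul (mul_ne_zero hq.ne' hpow) (exp_pos _).ne', log_mul hq.ne' hpow,
    log_rpow hs, log_exp]

theorem isSlowPhase_exp_rpow (hq : 0 < q) :
    IsSlowPhase (fun s => exp (s ^ q)) (expRpowDeriv q) (expRpowCurvature (1 - 1 / q))
      (expRpowCurvatureDeriv (1 - 1 / q)) (expRpowCurvatureDeriv₂ (1 - 1 / q)) where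
  tailIntegrable := tailIntegrable_doubleExp hq
  tendsto := tendsto_exp_rpow hq
  deriv_pos _ hs := expRpowDeriv_pos hq hs
  hasDerivAt _ hs := hasDerivAt_exp_rpow hs
  hasDerivAt_deriv _ hs := hasDerivAt_expRpowDeriv hq.ne' hs
  log_deriv_isLittleO :=
    (log_expRpowDeriv_isBigO hq).trans_isLittleO (rpow_isLittleO_exp_rpow hq)
  hasDerivAt_curvature := (eventually_gt_atTop 1).mono fun _ => hasDerivAt_expRpowCurvature
  hasDerivAt_curvature_deriv :=
    (eventually_gt_atTop 1).mono fun _ => hasDerivAt_expRpowCurvatureDeriv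
  curvature_isBigO := isBigO_mul_of_tendsto (c := 1 + 0) <| by
    simpa using (tendsto_const_mul_inv_log_pow (1 - 1 / q) one_ne_zero).const_add 1
  curvature_deriv_isBigO := (isBigO_mul_of_tendsto
    (((tendsto_const_mul_inv_log_pow (1 - 1 / q) one_ne_zero).const_add 1).add
      (tendsto_const_mul_inv_log_pow (1 - 1 / q) two_ne_zero))).neg_left.congr_left fun t => by
    rw [expRpowCurvatureDeriv]; ring
  curvature_deriv₂_isBigO := (isBigO_mul_of_tendsto
    ((((tendsto_const_mul_inv_log_pow (2 * (1 - 1 / q)) one_ne_zero).const_add 2).add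
      (tendsto_const_mul_inv_log_pow (3 * (1 - 1 / q)) two_ne_zero)).add
      (tendsto_const_mul_inv_log_pow (2 * (1 - 1 / q)) three_ne_zero))).congr_left fun t => by
    rw [expRpowCurvatureDeriv₂]; ring

theorem phaseError_exp_rpow_isBigO (hq : 0 < q) :
    phaseError (fun s => exp (s ^ q)) (expRpowDeriv q) =O[atTop]
      fun s => s ^ q / exp (s ^ q) :=
  ((const_isBigO_rpow hq 1).add (log_expRpowDeriv_isBigO hq).abs_left).mul
    (isBigO_refl (fun s : ℝ => (exp (s ^ q))⁻¹) atTop)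

theorem tendsto_rpow_div_exp_rpow (hq : 0 < q) :
    Tendsto (fun s : ℝ => s ^ q / exp (s ^ q)) atTop (𝓝 0) :=
  (rpow_isLittleO_exp_rpow hq).tendsto_div_nhds_zero

theorem invB₁_doubleExp_sub_isBigO (hq : 0 < q) :
    (fun s => invB₁ (doubleExp q) s - (1 + (1 - 1 / q) * (s ^ q)⁻¹)) =O[atTop]
      fun s => s ^ q / exp (s ^ q) := by
  refine ((isSlowPhase_exp_rpow hq).invB₁_sub_isBigO.trans
    (phaseError_exp_rpow_isBigO hq)).congr_left fun s => ?_
  rw [expRpowCurvature, log_exp, mul_inv_cancel_left₀ (exp_pos _).ne']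
  rfl

theorem invB₂_doubleExp_sub_isBigO (hq : 0 < q) :
    (fun s => invB₂ (doubleExp q) s -
      (1 + (1 - 1 / q) * (s ^ q)⁻¹ + (1 - 1 / q) * (s ^ q)⁻¹ ^ 2)) =O[atTop]
      fun s => s ^ q / exp (s ^ q) := by
  refine ((isSlowPhase_exp_rpow hq).invB₂_sub_isBigO.trans
    (phaseError_exp_rpow_isBigO hq)).congr_left fun s => ?_
  rw [expRpowCurvatureDeriv, log_exp, neg_mul, mul_neg, neg_neg, ← mul_assoc, ← mul_pow,
    mul_inv_cancel₀ (exp_pos _).ne', one_pow, one_mul]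
  rfl

theorem tendsto_const_mul_inv_rpow_pow (hq : 0 < q) (c : ℝ) {n : ℕ} (hn : n ≠ 0) :
    Tendsto (fun s : ℝ => c * (s ^ q)⁻¹ ^ n) atTop (𝓝 0) := by
  simpa [hn] using ((tendsto_rpow_atTop hq).inv_tendsto_atTop.pow n).const_mul c

theorem tendsto_invB₂_doubleExp (hq : 0 < q) : Tendsto (invB₂ (doubleExp q)) atTop (𝓝 1) := by
  have herror := (invB₂_doubleExp_sub_isBigO hq).trans_tendsto (tendsto_rpow_div_exp_rpow hq)
  have hmain := ((tendsto_const_mul_inv_rpow_pow hq (1 - 1 / q) one_ne_zero).const_add 1).add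
    (tendsto_const_mul_inv_rpow_pow hq (1 - 1 / q) two_ne_zero)
  simpa using herror.add hmain

theorem hasGrowthExponent_doubleExp (hq : 0 < q) : HasGrowthExponent (doubleExp q) 1 := by
  constructor
  · filter_upwards [eventually_ge_atTop 0] with s hs
    exact (tailIntegrable_doubleExp hq).integrableOn.mono_set (Ioi_subset_Ioi hs)
  · have hinv := (tendsto_invB₂_doubleExp hq).inv₀ one_ne_zero
    rw [inv_one] at hinv
    exact hinv.congr fun s => (one_div _).symm

end DoubleExp

section Model

theorem modelNonlinearity_one_eq :
    modelNonlinearity 1 = fun s => 4 * exp (exp s) / exp (2 * s) := by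
  funext s; rw [modelNonlinearity, if_pos rfl]

theorem modelNonlinearity_one_pos (s : ℝ) : 0 < modelNonlinearity 1 s := by
  rw [modelNonlinearity_one_eq]; positivity

theorem hasDerivAt_modelNonlinearity_one (s : ℝ) :
    HasDerivAt (modelNonlinearity 1) (modelNonlinearity 1 s * (exp s - 2)) s := by
  rw [modelNonlinearity_one_eq]
  have hden : HasDerivAt (fun y : ℝ => exp (2 * y)) (exp (2 * s) * 2) s := by
    simpa using ((hasDerivAt_id s).const_mul (2 : ℝ)).exp
  refine (((hasDerivAt_exp s).exp.const_mul 4).div hden (exp_pos _).ne').congr_deriv ?_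
  have := exp_pos (2 * s)
  field_simp

theorem deriv_modelNonlinearity_one :
    deriv (modelNonlinearity 1) = fun s => modelNonlinearity 1 s * (exp s - 2) :=
  funext fun s => (hasDerivAt_modelNonlinearity_one s).deriv

theorem deriv_deriv_modelNonlinearity_one (s : ℝ) :
    deriv (deriv (modelNonlinearity 1)) s =
      modelNonlinearity 1 s * ((exp s - 2) ^ 2 + exp s) := by
  rw [deriv_modelNonlinearity_one]
  refine (((hasDerivAt_modelNonlinearity_one s).mul
    ((hasDerivAt_exp s).sub_const 2)).congr_deriv ?_).deriv
  ring

/-- The closed form of the tail integral `G` of `modelNonlinearity 1`, in the variable `L = exp s`;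
along the model solution `L = log (1 / ‖x‖ ^ 2)`, and `modelTail L` is then `wFun x`. -/
def modelTail (L : ℝ) : ℝ := exp (-L) * (L + 1) / 4

theorem tendsto_modelTail : Tendsto modelTail atTop (𝓝 0) := by
  have hsum := (tendsto_pow_mul_exp_neg_atTop_nhds_zero 1).add
    (tendsto_pow_mul_exp_neg_atTop_nhds_zero 0)
  have hquot := hsum.div_const 4
  rw [add_zero, zero_div] at hquot
  exact hquot.congr fun L => by rw [modelTail]; ring

theorem hasDerivAt_neg_modelTail_exp (s : ℝ) :
    HasDerivAt (fun y => -modelTail (exp y)) (1 / modelNonlinearity 1 s) s := by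
  have hexp := hasDerivAt_exp s
  refine (((hexp.neg.exp.mul (hexp.add_const 1)).div_const 4).neg).congr_deriv ?_
  simp only [modelNonlinearity_one_eq, two_mul, Pi.neg_apply, exp_add, exp_neg]
  have := exp_pos (exp s)
  field_simp
  ring

theorem tailIntegral_modelNonlinearity_one (s : ℝ) :
    tailIntegral (modelNonlinearity 1) s = modelTail (exp s) := by
  have hFTC := MeasureTheory.integral_Ioi_of_hasDerivAt_of_nonneg' (a := s)
    (fun y _ => hasDerivAt_neg_modelTail_exp y)
    (fun y _ => (one_div_pos.2 (modelNonlinearity_one_pos y)).le)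
    (by simpa using (tendsto_modelTail.comp tendsto_exp_atTop).neg)
  rw [tailIntegral, hFTC, zero_sub, neg_neg]

theorem modelTail_pos {L : ℝ} (hL : 0 < L) : 0 < modelTail L := by
  rw [modelTail]; positivity

theorem tendsto_modelTail_nhdsGT : Tendsto modelTail atTop (𝓝[>] 0) :=
  tendsto_nhdsWithin_iff.2
    ⟨tendsto_modelTail, (eventually_gt_atTop 0).mono fun _ hL => modelTail_pos hL⟩

theorem neg_log_modelTail {L : ℝ} (hL : 0 < L) :
    -log (modelTail L) = L - log (L + 1) + log 4 := by
  have := exp_pos (-L)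
  rw [modelTail, log_div (by positivity) (by norm_num), log_mul (by positivity) (by positivity),
    log_exp]
  ring

theorem modelNonlinearity_mul_modelTail {L : ℝ} (hL : 0 < L) :
    modelNonlinearity 1 (log L) * modelTail L = (L + 1) / L ^ 2 := by
  simp only [modelNonlinearity_one_eq, modelTail, two_mul, exp_add, exp_neg, exp_log hL]
  have := exp_pos L
  field_simp

theorem derivTail_model {L : ℝ} (hL : 0 < L) :
    derivTail (modelNonlinearity 1) (log L) = (L - 2) * ((L + 1) / L ^ 2) := by
  simp only [derivTail, tailIntegral_modelNonlinearity_one, deriv_modelNonlinearity_one,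
    exp_log hL, ← modelNonlinearity_mul_modelTail hL]
  ring

theorem invB₁_model {L : ℝ} (hL : 0 < L) : invB₁ (modelNonlinearity 1) (log L) =
    (-log (modelTail L) / L) * (1 + 2 / L) := by
  rw [invB₁, ← derivTail, derivTail_model hL, tailIntegral_modelNonlinearity_one, exp_log hL]
  field_simp
  ring

theorem invB₂_model {L : ℝ} (hL : 2 < L) : invB₂ (modelNonlinearity 1) (log L) =
    (-log (modelTail L) / L) * (-log (modelTail L) / L) * ((1 + 1 / L) * (1 + 4 / L)) := by
  have hL0 : 0 < L := by linarith
  have hL2 : L - 2 ≠ 0 := by linarith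
  have hg := (modelNonlinearity_one_pos (log L)).ne'
  have hsecond : modelNonlinearity 1 (log L) * (modelNonlinearity 1 (log L) * ((L - 2) ^ 2 + L)) *
      modelTail L / (modelNonlinearity 1 (log L) * (L - 2)) =
      ((L + 1) / L ^ 2) * ((L - 2) ^ 2 + L) / (L - 2) := by
    rw [← modelNonlinearity_mul_modelTail hL0]; field_simp
  rw [invB₂, ← derivTail, derivTail_model hL0, tailIntegral_modelNonlinearity_one,
    deriv_deriv_modelNonlinearity_one, deriv_modelNonlinearity_one]
  simp only [exp_log hL0]
  rw [hsecond]
  field_simp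
  ring

theorem tendsto_log_div_self : Tendsto (fun L : ℝ => log L / L) atTop (𝓝 0) :=
  isLittleO_log_id_atTop.tendsto_div_nhds_zero

theorem const_div_isBigO_log_div (c : ℝ) :
    (fun L : ℝ => c / L) =O[atTop] fun L => log L / L := by
  have hconst : (fun _ : ℝ => c) =O[atTop] log :=
    (isLittleO_const_left.2 (Or.inr (tendsto_norm_atTop_atTop.comp tendsto_log_atTop))).isBigO
  simpa only [div_eq_mul_inv] using hconst.mul (isBigO_refl (fun L : ℝ => L⁻¹) atTop)

theorem log_add_one_sub_log_isBigO :
    (fun L : ℝ => log (L + 1) - log L) =O[atTop] fun L => L⁻¹ := by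
  refine IsBigO.of_bound' ?_
  filter_upwards [eventually_gt_atTop 0] with L hL
  rw [norm_of_nonneg (sub_nonneg.2 (log_le_log hL (by linarith))),
    norm_of_nonneg (inv_pos.2 hL).le, ← log_div (by linarith) hL.ne']
  refine (log_le_sub_one_of_pos (by positivity)).trans_eq ?_
  field_simp
  ring

theorem neg_log_modelTail_div_sub_one_isBigO :
    (fun L => -log (modelTail L) / L - 1) =O[atTop] fun L => log L / L := by
  have hlog : (fun L : ℝ => log (L + 1) - log L) =O[atTop] fun _ => (1 : ℝ) :=
    log_add_one_sub_log_isBigO.trans (tendsto_inv_atTop_zero.isBigO_one ℝ)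
  have hrest := (hlog.mul (isBigO_refl (fun L : ℝ => L⁻¹) atTop)).trans
    (by simpa using const_div_isBigO_log_div 1)
  refine (((const_div_isBigO_log_div (log 4)).sub (isBigO_refl _ atTop)).sub hrest).congr' ?_
    EventuallyEq.rfl
  filter_upwards [eventually_gt_atTop 0] with L hL
  rw [neg_log_modelTail hL]
  field_simp
  ring

theorem tendsto_neg_log_modelTail_div :
    Tendsto (fun L => -log (modelTail L) / L) atTop (𝓝 1) := by
  simpa using
    (neg_log_modelTail_div_sub_one_isBigO.trans_tendsto tendsto_log_div_self).add_const 1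

theorem one_add_div_sub_one_isBigO (c : ℝ) :
    (fun L : ℝ => 1 + c / L - 1) =O[atTop] fun L => log L / L := by
  simpa using const_div_isBigO_log_div c

theorem invB₁_model_sub_one_isBigO :
    (fun L => invB₁ (modelNonlinearity 1) (log L) - 1) =O[atTop] fun L => log L / L := by
  refine (isBigO_mul_sub_mul neg_log_modelTail_div_sub_one_isBigO (one_add_div_sub_one_isBigO 2)
    (isBigO_refl _ _) (isBigO_refl _ _) (tendsto_log_div_self.isBigO_one ℝ)).congr' ?_
    EventuallyEq.rfl
  filter_upwards [eventually_gt_atTop 0] with L hL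
  rw [invB₁_model hL, mul_one]

theorem invB₂_model_sub_one_isBigO :
    (fun L => invB₂ (modelNonlinearity 1) (log L) - 1) =O[atTop] fun L => log L / L := by
  have herr := tendsto_log_div_self.isBigO_one ℝ
  have hone := isBigO_refl (fun _ : ℝ => (1 : ℝ)) atTop
  have hlog := neg_log_modelTail_div_sub_one_isBigO
  have hlog_sq : (fun L => (-log (modelTail L) / L) * (-log (modelTail L) / L) - 1)
      =O[atTop] fun L => log L / L := by
    simpa only [mul_one] using isBigO_mul_sub_mul hlog hlog hone hone herr
  have hrational : (fun L : ℝ => (1 + 1 / L) * (1 + 4 / L) - 1) =O[atTop] fun L => log L / L := by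
    simpa only [mul_one] using isBigO_mul_sub_mul (one_add_div_sub_one_isBigO 1)
      (one_add_div_sub_one_isBigO 4) hone hone herr
  refine (isBigO_mul_sub_mul hlog_sq hrational hone hone herr).congr' ?_ EventuallyEq.rfl
  filter_upwards [eventually_gt_atTop 2] with L hL
  rw [invB₂_model hL, mul_one]

end Model

section Discrepancy

variable {q : ℝ}

/-- The approximate solution `ũ` as a function of `L = log (1 / ‖x‖ ^ 2)`. -/
def approxProfile (q L : ℝ) : ℝ := tailInverse (doubleExp q) (modelTail L)

theorem tendsto_approxProfile (hq : 0 < q) : Tendsto (approxProfile q) atTop atTop :=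
  (tailIntegrable_doubleExp hq).tendsto_tailInverse.comp tendsto_modelTail_nhdsGT

theorem tendsto_exp_approxProfile_div (hq : 0 < q) :
    Tendsto (fun L => exp (approxProfile q L ^ q) / L) atTop (𝓝 1) := by
  have hphase : Tendsto (fun s => -log (tailIntegral (doubleExp q) s) / exp (s ^ q)) atTop
      (𝓝 1) := by
    have hdiff := ((isSlowPhase_exp_rpow hq).neg_log_tailIntegral_div_isBigO.trans_tendsto
      (isSlowPhase_exp_rpow hq).tendsto_phaseError).add_const 1
    simp only [sub_add_cancel, zero_add] at hdiff
    exact hdiff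
  have hquot :=
    tendsto_neg_log_modelTail_div.div (hphase.comp (tendsto_approxProfile hq)) one_ne_zero
  rw [div_one] at hquot
  refine hquot.congr' ?_
  filter_upwards [tendsto_modelTail_nhdsGT.eventually
      (tailIntegrable_doubleExp hq).eventually_tailInverse_spec,
    tendsto_neg_log_modelTail_div.eventually_ne one_ne_zero,
    eventually_gt_atTop 0] with L hspec hne hL
  have hlog : log (modelTail L) ≠ 0 := fun hzero => hne (by rw [hzero, neg_zero, zero_div])
  have := exp_pos (tailInverse (doubleExp q) (modelTail L) ^ q)
  rw [Pi.div_apply, Function.comp_apply, approxProfile, hspec.2]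
  field_simp

theorem tendsto_log_div_sqrt : Tendsto (fun t : ℝ => log t / √t) atTop (𝓝 0) := by
  simpa only [sqrt_eq_rpow] using
    (isLittleO_log_rpow_atTop (r := 1 / 2) (by norm_num)).tendsto_div_nhds_zero

theorem tendsto_sqrt_mul_log_div : Tendsto (fun t : ℝ => √t * (log t / t)) atTop (𝓝 0) := by
  refine tendsto_log_div_sqrt.congr fun t => ?_
  rw [mul_comm, div_mul_eq_mul_div, mul_div_assoc, sqrt_div_self', mul_one_div]

theorem tendsto_sqrt_div_log : Tendsto (fun t : ℝ => √t / log t) atTop atTop := by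
  have hpos : ∀ᶠ t : ℝ in atTop, log t / √t ∈ Ioi 0 := by
    filter_upwards [eventually_gt_atTop 1] with t ht
    exact div_pos (log_pos ht) (sqrt_pos.2 (by linarith))
  refine (tendsto_nhdsWithin_iff.2
    ⟨tendsto_log_div_sqrt, hpos⟩).inv_tendsto_nhdsGT_zero.congr fun t => ?_
  rw [Pi.inv_apply, inv_div]

theorem tendsto_sqrt_div_sqrt_exp_approxProfile (hq : 0 < q) :
    Tendsto (fun L => √L / √(exp (approxProfile q L ^ q))) atTop (𝓝 1) := by
  have hinv := ((tendsto_exp_approxProfile_div hq).inv₀ one_ne_zero).sqrt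
  rw [inv_one, sqrt_one] at hinv
  refine hinv.congr fun L => ?_
  rw [inv_div, sqrt_div' _ (exp_pos _).le]

theorem tendsto_sqrt_mul_rpow_div_exp_approxProfile (hq : 0 < q) :
    Tendsto (fun L => √L * (approxProfile q L ^ q / exp (approxProfile q L ^ q)))
      atTop (𝓝 0) := by
  have hmul := (tendsto_sqrt_div_sqrt_exp_approxProfile hq).mul (tendsto_sqrt_mul_log_div.comp
    ((tendsto_exp_rpow hq).comp (tendsto_approxProfile hq)))
  rw [mul_zero] at hmul
  refine hmul.congr fun L => ?_
  have := sqrt_pos.2 (exp_pos (approxProfile q L ^ q))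
  simp only [Function.comp, log_exp]
  field_simp

theorem tendsto_sqrt_mul_inv_approxProfile (hq : 0 < q) :
    Tendsto (fun L => √L * (approxProfile q L ^ q)⁻¹) atTop atTop := by
  refine ((tendsto_sqrt_div_sqrt_exp_approxProfile hq).pos_mul_atTop one_pos
    (tendsto_sqrt_div_log.comp
      ((tendsto_exp_rpow hq).comp (tendsto_approxProfile hq)))).congr fun L => ?_
  have := sqrt_pos.2 (exp_pos (approxProfile q L ^ q))
  simp only [Function.comp, log_exp]
  field_simp

theorem tendsto_mul_of_isBigO {α : Type*} {l : Filter α} {r X e : α → ℝ} (hX : X =O[l] e)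
    (he : Tendsto (fun L => r L * e L) l (𝓝 0)) : Tendsto (fun L => r L * X L) l (𝓝 0) :=
  ((isBigO_refl r l).mul hX).trans_tendsto he

theorem tendsto_sqrt_mul_invB₁_sub (hq : 0 < q) :
    Tendsto (fun L => √L * (invB₁ (doubleExp q) (approxProfile q L) -
        invB₁ (modelNonlinearity 1) (log L)) -
      (1 - 1 / q) * (√L * (approxProfile q L ^ q)⁻¹)) atTop (𝓝 0) := by
  have hf := tendsto_mul_of_isBigO
    ((invB₁_doubleExp_sub_isBigO hq).comp_tendsto (tendsto_approxProfile hq))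
    (tendsto_sqrt_mul_rpow_div_exp_approxProfile hq)
  have hg := tendsto_mul_of_isBigO invB₁_model_sub_one_isBigO tendsto_sqrt_mul_log_div
  have hsub := hf.sub hg
  rw [sub_zero] at hsub
  exact hsub.congr fun L => by simp only [Function.comp]; ring

theorem tendsto_sqrt_mul_invB₂_sub (hq : 0 < q) :
    Tendsto (fun L => √L * (invB₂ (doubleExp q) (approxProfile q L) -
        invB₂ (modelNonlinearity 1) (log L)) -
      (1 - 1 / q) * (√L * ((approxProfile q L ^ q)⁻¹ + (approxProfile q L ^ q)⁻¹ ^ 2)))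
      atTop (𝓝 0) := by
  have hf := tendsto_mul_of_isBigO
    ((invB₂_doubleExp_sub_isBigO hq).comp_tendsto (tendsto_approxProfile hq))
    (tendsto_sqrt_mul_rpow_div_exp_approxProfile hq)
  have hg := tendsto_mul_of_isBigO invB₂_model_sub_one_isBigO tendsto_sqrt_mul_log_div
  have hsub := hf.sub hg
  rw [sub_zero] at hsub
  exact hsub.congr fun L => by simp only [Function.comp]; ring

/-- The discrepancy `√2 (-log ‖x‖) ^ (1 / 2) (R₁ + R₂)` of `doubleExp q` as a function of
`L = log (1 / ‖x‖ ^ 2)`. -/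
def discrepancyProfile (q L : ℝ) : ℝ :=
  |√L * (invB₁ (doubleExp q) (approxProfile q L) - invB₁ (modelNonlinearity 1) (log L))| +
    |√L * (invB₂ (doubleExp q) (approxProfile q L) - invB₂ (modelNonlinearity 1) (log L))|

theorem tendsto_discrepancyProfile_one : Tendsto (discrepancyProfile 1) atTop (𝓝 0) := by
  have h₁ := (tendsto_sqrt_mul_invB₁_sub one_pos).abs
  have h₂ := (tendsto_sqrt_mul_invB₂_sub one_pos).abs
  simp only [div_one, sub_self, zero_mul, sub_zero, abs_zero] at h₁ h₂
  have hsum := h₁.add h₂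
  rw [add_zero] at hsum
  exact hsum

theorem tendsto_discrepancyProfile_atTop (hq : 0 < q) (hq1 : q ≠ 1) :
    Tendsto (discrepancyProfile q) atTop atTop := by
  have hcoeff : 0 < |1 - 1 / q| := by
    rw [abs_pos, sub_ne_zero, ne_comm, ne_eq, div_eq_one_iff_eq hq.ne']
    exact hq1.symm
  have hmain := ((tendsto_sqrt_mul_inv_approxProfile hq).const_mul_atTop hcoeff).atTop_add
    (tendsto_sqrt_mul_invB₁_sub hq).abs.neg
  refine tendsto_atTop_mono (fun L => ?_) hmain
  set D := √L * (invB₁ (doubleExp q) (approxProfile q L) - invB₁ (modelNonlinearity 1) (log L))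
  set M := √L * (approxProfile q L ^ q)⁻¹
  calc |1 - 1 / q| * M + -|D - (1 - 1 / q) * M|
      ≤ |1 - 1 / q| * |M| - |D - (1 - 1 / q) * M| := by
        rw [← sub_eq_add_neg]; gcongr; exact le_abs_self M
    _ ≤ |D| := by
        rw [← abs_mul]
        linarith [abs_sub_abs_le_abs_sub ((1 - 1 / q) * M) D, abs_sub_comm D ((1 - 1 / q) * M)]
    _ ≤ discrepancyProfile q L := le_add_of_nonneg_right (abs_nonneg _)

theorem log_one_div_norm_sq {E : Type*} [NormedAddCommGroup E] (x : E) :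
    log (1 / ‖x‖ ^ 2) = 2 * -log ‖x‖ := by
  rw [one_div, log_inv, log_pow]; push_cast; ring

theorem tendsto_log_one_div_norm_sq {E : Type*} [NormedAddCommGroup E] :
    Tendsto (fun x : E => log (1 / ‖x‖ ^ 2)) (𝓝[≠] 0) atTop := by
  simp only [log_one_div_norm_sq]
  exact (tendsto_neg_atBot_atTop.comp
    (tendsto_log_nhdsGT_zero.comp tendsto_norm_nhdsNE_zero)).const_mul_atTop two_pos

theorem discrepancy_eq_discrepancyProfile (q : ℝ) {x : Plane} (hx : 0 < log (1 / ‖x‖ ^ 2)) :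
    (-log ‖x‖) ^ (1 / 2 : ℝ) * (R₁ (doubleExp q) 1 x + R₂ (doubleExp q) 1 x) =
      (√2)⁻¹ * discrepancyProfile q (log (1 / ‖x‖ ^ 2)) := by
  have hmodel : modelSolution 1 x = log (log (1 / ‖x‖ ^ 2)) := by rw [modelSolution, if_pos rfl]
  have happrox : approxSolution (doubleExp q) 1 x = approxProfile q (log (1 / ‖x‖ ^ 2)) := by
    rw [approxSolution, hmodel, tailIntegral_modelNonlinearity_one, exp_log hx, approxProfile]
  have hsqrt : (-log ‖x‖) ^ (1 / 2 : ℝ) = (√2)⁻¹ * √(log (1 / ‖x‖ ^ 2)) := by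
    rw [← sqrt_eq_rpow, log_one_div_norm_sq, sqrt_mul zero_le_two]
    field_simp
  rw [hsqrt, R₁, R₂, hmodel, happrox, discrepancyProfile, abs_mul, abs_mul,
    abs_of_nonneg (sqrt_nonneg _)]
  ring

theorem discrepancyCondition_doubleExp_iff (hq : 0 < q) :
    DiscrepancyCondition (doubleExp q) 1 ↔ q = 1 := by
  have heq : (fun x : Plane => (-log ‖x‖) ^ (1 / 2 : ℝ) *
      (R₁ (doubleExp q) 1 x + R₂ (doubleExp q) 1 x)) =ᶠ[𝓝[≠] 0]
      fun x => (√2)⁻¹ * discrepancyProfile q (log (1 / ‖x‖ ^ 2)) :=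
    (tendsto_log_one_div_norm_sq.eventually_gt_atTop 0).mono fun x hx =>
      discrepancy_eq_discrepancyProfile q hx
  rw [DiscrepancyCondition, tendsto_congr' heq]
  constructor
  · intro hlim
    by_contra hq1
    have hdiv := ((tendsto_discrepancyProfile_atTop hq hq1).const_mul_atTop
      (show 0 < (√2)⁻¹ by positivity)).comp (tendsto_log_one_div_norm_sq (E := Plane))
    exact not_tendsto_nhds_of_tendsto_atTop hdiv 0 hlim
  · rintro rfl
    simpa using (tendsto_discrepancyProfile_one.comp tendsto_log_one_div_norm_sq).const_mul (√2)⁻¹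

end Discrepancy

section Radial

variable {E : Type*} [NormedAddCommGroup E] [InnerProductSpace ℝ E] {h h' : ℝ → ℝ} {h'' : ℝ}
  {x : E}

theorem hasFDerivAt_comp_norm_sq {d : ℝ} (hd : HasDerivAt h d (‖x‖ ^ 2)) :
    HasFDerivAt (fun z : E => h (‖z‖ ^ 2)) ((2 * d) • innerSL ℝ x) x := by
  refine (hd.comp_hasFDerivAt x (hasStrictFDerivAt_norm_sq x).hasFDerivAt).congr_fderiv ?_
  rw [two_nsmul, ← two_smul ℝ, smul_smul, mul_comm]

theorem fderiv_fderiv_comp_norm_sq (hh : ∀ᶠ ρ in 𝓝 (‖x‖ ^ 2), HasDerivAt h (h' ρ) ρ)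
    (hh' : HasDerivAt h' h'' (‖x‖ ^ 2)) (v w : E) :
    fderiv ℝ (fderiv ℝ fun z : E => h (‖z‖ ^ 2)) x v w =
      2 * h' (‖x‖ ^ 2) * inner ℝ v w + 4 * h'' * inner ℝ x v * inner ℝ x w := by
  have hnorm : Tendsto (fun z : E => ‖z‖ ^ 2) (𝓝 x) (𝓝 (‖x‖ ^ 2)) :=
    (continuous_norm.pow 2).tendsto x
  have hfirst : fderiv ℝ (fun z : E => h (‖z‖ ^ 2)) =ᶠ[𝓝 x]
      fun z => (2 * h' (‖z‖ ^ 2)) • innerSL ℝ z :=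
    (hnorm.eventually hh).mono fun z hz => (hasFDerivAt_comp_norm_sq hz).fderiv
  have hsecond := ((hasFDerivAt_comp_norm_sq hh').const_mul 2).smul
    (innerSL ℝ (E := E)).hasFDerivAt
  rw [(hsecond.congr_of_eventuallyEq hfirst).fderiv]
  simp only [_root_.add_apply, _root_.smul_apply, ContinuousLinearMap.smulRight_apply,
    smul_eq_mul, innerSL_apply_apply ℝ]
  ring

theorem laplacian_comp_norm_sq [FiniteDimensional ℝ E]
    (hh : ∀ᶠ ρ in 𝓝 (‖x‖ ^ 2), HasDerivAt h (h' ρ) ρ) (hh' : HasDerivAt h' h'' (‖x‖ ^ 2)) :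
    Laplacian.laplacian (fun z : E => h (‖z‖ ^ 2)) x =
      2 * Module.finrank ℝ E * h' (‖x‖ ^ 2) + 4 * ‖x‖ ^ 2 * h'' := by
  have hdiag : ∀ i, 2 * h' (‖x‖ ^ 2) *
        inner ℝ (stdOrthonormalBasis ℝ E i) (stdOrthonormalBasis ℝ E i) +
      4 * h'' * inner ℝ x (stdOrthonormalBasis ℝ E i) * inner ℝ x (stdOrthonormalBasis ℝ E i) =
      2 * h' (‖x‖ ^ 2) + 4 * h'' * ‖inner ℝ x (stdOrthonormalBasis ℝ E i)‖ ^ 2 := fun i => by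
    rw [real_inner_self_eq_norm_sq, (stdOrthonormalBasis ℝ E).norm_eq_one, norm_eq_abs, sq_abs]
    ring
  rw [InnerProductSpace.laplacian_eq_iteratedFDeriv_stdOrthonormalBasis]
  simp only [iteratedFDeriv_two_apply, Matrix.cons_val_zero, Matrix.cons_val_one,
    fderiv_fderiv_comp_norm_sq hh hh', hdiag]
  rw [Finset.sum_add_distrib, Finset.sum_const, ← Finset.mul_sum,
    (stdOrthonormalBasis ℝ E).sum_sq_norm_inner_left, Finset.card_univ, Fintype.card_fin,
    nsmul_eq_mul]
  ring

theorem hasDerivAt_log_one_div {ρ : ℝ} (hρ : ρ ≠ 0) :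
    HasDerivAt (fun ρ => log (1 / ρ)) (-ρ⁻¹) ρ := by
  simpa only [one_div, log_inv] using (hasDerivAt_log hρ).fun_neg

theorem laplacian_comp_log_one_div_norm_sq {y y' : ℝ → ℝ} {y'' : ℝ} {x : Plane} (hx : x ≠ 0)
    (hy : ∀ᶠ L in 𝓝 (log (1 / ‖x‖ ^ 2)), HasDerivAt y (y' L) L)
    (hy' : HasDerivAt y' y'' (log (1 / ‖x‖ ^ 2))) :
    Laplacian.laplacian (fun z : Plane => y (log (1 / ‖z‖ ^ 2))) x = 4 / ‖x‖ ^ 2 * y'' := by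
  have hpos : 0 < ‖x‖ ^ 2 := by positivity
  have hlog := hasDerivAt_log_one_div hpos.ne'
  have hfirst : ∀ᶠ ρ in 𝓝 (‖x‖ ^ 2),
      HasDerivAt (fun ρ => y (log (1 / ρ))) (y' (log (1 / ρ)) * -ρ⁻¹) ρ := by
    filter_upwards [hlog.continuousAt.eventually hy, lt_mem_nhds hpos] with ρ hyρ hρ
    exact hyρ.comp ρ (hasDerivAt_log_one_div hρ.ne')
  have hsecond := (hy'.comp (‖x‖ ^ 2) hlog).mul (hasDerivAt_inv hpos.ne').neg
  rw [laplacian_comp_norm_sq hfirst hsecond, finrank_euclideanSpace_fin]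
  simp only [Function.comp, Pi.neg_apply]
  field_simp
  push_cast
  ring

/-- The function `y` (with derivative `y'`) solves on `(L₀, ∞)` the equation
`y'' = -exp (-L) f(y) / 4`, to which `-Δ u = f(u)` reduces for functions
`u x = y (log (1 / ‖x‖ ^ 2))` on the plane. -/
structure IsRadialProfile (f : ℝ → ℝ) (L₀ : ℝ) (y y' : ℝ → ℝ) : Prop where
  hasDerivAt : ∀ L, L₀ < L → HasDerivAt y (y' L) L
  hasDerivAt_deriv : ∀ L, L₀ < L → HasDerivAt y' (-(1 / 4 * exp (-L) * f (y L))) L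

variable {f y y' : ℝ → ℝ} {L₀ : ℝ}

theorem contDiffOn_succ_of_hasDerivAt {s : Set ℝ} (hs : IsOpen s) {n : ℕ} {u v : ℝ → ℝ}
    (huv : ∀ L ∈ s, HasDerivAt u (v L) L) (hv : ContDiffOn ℝ n v s) :
    ContDiffOn ℝ (n + 1 : ℕ) u s := by
  push_cast
  refine (contDiffOn_succ_iff_deriv_of_isOpen hs).2
    ⟨fun L hL => (huv L hL).differentiableAt.differentiableWithinAt, by simp, ?_⟩
  exact hv.congr fun L hL => (huv L hL).deriv

theorem IsRadialProfile.contDiffOn (hy : IsRadialProfile f L₀ y y') (hf : ContDiff ℝ ∞ f) :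
    ContDiffOn ℝ ∞ y (Ioi L₀) := by
  suffices hboth : ∀ n : ℕ, ContDiffOn ℝ n y (Ioi L₀) ∧ ContDiffOn ℝ n y' (Ioi L₀) from
    contDiffOn_infty.2 fun n => (hboth n).1
  intro n
  induction n with
  | zero =>
    simp only [Nat.cast_zero, contDiffOn_zero]
    exact ⟨fun L hL => (hy.hasDerivAt L hL).continuousAt.continuousWithinAt,
      fun L hL => (hy.hasDerivAt_deriv L hL).continuousAt.continuousWithinAt⟩
  | succ n ih =>
    have hfy : ContDiffOn ℝ n (fun L => f (y L)) (Ioi L₀) :=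
      (contDiff_infty.1 hf n).comp_contDiffOn ih.1
    exact ⟨contDiffOn_succ_of_hasDerivAt isOpen_Ioi hy.hasDerivAt ih.2,
      contDiffOn_succ_of_hasDerivAt isOpen_Ioi hy.hasDerivAt_deriv
        ((contDiffOn_const.mul contDiffOn_id.neg.exp).mul hfy).neg⟩

theorem lt_log_one_div_norm_sq {E : Type*} [NormedAddCommGroup E] {x : E}
    (hx : x ∈ Metric.ball (0 : E) (exp (-L₀ / 2)) \ {0}) :
    L₀ < log (1 / ‖x‖ ^ 2) := by
  have hlog := (log_lt_iff_lt_exp (norm_pos_iff.2 hx.2)).2 (mem_ball_zero_iff.1 hx.1)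
  rw [log_one_div_norm_sq]
  linarith

theorem contDiffAt_log_one_div_norm_sq (hx : x ≠ 0) :
    ContDiffAt ℝ ∞ (fun z : E => log (1 / ‖z‖ ^ 2)) x := by
  have hpos : 0 < ‖x‖ ^ 2 := by positivity
  exact (contDiffAt_const.div (contDiff_norm_sq ℝ).contDiffAt hpos.ne').log (one_div_pos.2 hpos).ne'

theorem IsRadialProfile.isSmoothSingularSolution (hy : IsRadialProfile f L₀ y y')
    (hf : ContDiff ℝ ∞ f) (hpos : ∀ L, L₀ < L → 0 ≤ y L) (hlim : Tendsto y atTop atTop) :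
    IsSmoothSingularSolution f (exp (-L₀ / 2)) fun x => y (log (1 / ‖x‖ ^ 2)) where
  contDiffOn := (hy.contDiffOn hf).comp
    (fun _ hx => (contDiffAt_log_one_div_norm_sq hx.2).contDiffWithinAt)
    fun _ => lt_log_one_div_norm_sq
  nonneg _ hx := hpos _ (lt_log_one_div_norm_sq hx)
  radial x _ z _ hxz := by simp only [hxz]
  equation x hx := by
    have hL := lt_log_one_div_norm_sq hx
    have hx0 : 0 < ‖x‖ := norm_pos_iff.2 hx.2
    rw [laplacian_comp_log_one_div_norm_sq hx.2 ((lt_mem_nhds hL).mono hy.hasDerivAt)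
      (hy.hasDerivAt_deriv _ hL), exp_neg, exp_log (by positivity)]
    field_simp
  singular := hlim.comp tendsto_log_one_div_norm_sq

end Radial

section Wave

/-- Solutions `L ^ (1 / 4) cos (2 √L - δ)` of the linearized profile equation
`y'' + (1 / L + 3 / (16 L ^ 2)) y = 0`. -/
def wave (δ L : ℝ) : ℝ := √√L * cos (2 * √L - δ)

/-- The derivative of `wave δ`. -/
def waveDeriv (δ L : ℝ) : ℝ :=
  √√L * (cos (2 * √L - δ) * (4 * L)⁻¹ - sin (2 * √L - δ) * (√L)⁻¹)

variable {L : ℝ} (δ : ℝ)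

theorem hasDerivAt_sqrt_sqrt (hL : 0 < L) :
    HasDerivAt (fun y => √√y) (√√L * (4 * L)⁻¹) L := by
  have hsqrt := sqrt_pos.2 hL
  refine ((hasDerivAt_sqrt hL.ne').sqrt hsqrt.ne').congr_deriv ?_
  have := sqrt_pos.2 hsqrt
  field_simp
  linear_combination -4 * sq_sqrt hL.le - 4 * √L * sq_sqrt hsqrt.le

theorem hasDerivAt_two_sqrt_sub (hL : 0 < L) :
    HasDerivAt (fun y => 2 * √y - δ) (√L)⁻¹ L := by
  refine (((hasDerivAt_sqrt hL.ne').const_mul 2).sub_const δ).congr_deriv ?_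
  have := sqrt_pos.2 hL
  field_simp

theorem hasDerivAt_wave (hL : 0 < L) : HasDerivAt (wave δ) (waveDeriv δ L) L := by
  refine ((hasDerivAt_sqrt_sqrt hL).mul (hasDerivAt_two_sqrt_sub δ hL).cos).congr_deriv ?_
  rw [waveDeriv]
  ring

theorem hasDerivAt_waveDeriv (hL : 0 < L) :
    HasDerivAt (waveDeriv δ) (-(1 / L + 3 / (16 * L ^ 2)) * wave δ L) L := by
  have hsqrt := sqrt_pos.2 hL
  have hphase := hasDerivAt_two_sqrt_sub δ hL
  have hinv : HasDerivAt (fun y : ℝ => (4 * y)⁻¹) (-4 / (4 * L) ^ 2) L := by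
    simpa using ((hasDerivAt_id L).const_mul 4).fun_inv (by simpa using hL.ne')
  refine ((hasDerivAt_sqrt_sqrt hL).mul ((hphase.cos.mul hinv).sub
    (hphase.sin.mul ((hasDerivAt_sqrt hL.ne').fun_inv hsqrt.ne')))).congr_deriv ?_
  simp only [Pi.sub_apply, Pi.mul_apply, wave]
  generalize √√L = amplitude
  have hL_eq : L = √L ^ 2 := (sq_sqrt hL.le).symm
  generalize √L = r at *
  subst hL_eq
  field_simp
  ring

theorem wave_mul_waveDeriv_sub (hL : 0 < L) (δ' : ℝ) :
    wave δ L * waveDeriv δ' L - wave δ' L * waveDeriv δ L = sin (δ' - δ) := by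
  have hsqrt := sqrt_pos.2 hL
  calc wave δ L * waveDeriv δ' L - wave δ' L * waveDeriv δ L
      = √√L ^ 2 * (√L)⁻¹ * (sin (2 * √L - δ) * cos (2 * √L - δ') -
          cos (2 * √L - δ) * sin (2 * √L - δ')) := by rw [wave, wave, waveDeriv, waveDeriv]; ring
    _ = sin (2 * √L - δ - (2 * √L - δ')) := by
      rw [sq_sqrt hsqrt.le, mul_inv_cancel₀ hsqrt.ne', one_mul, ← sin_sub]
    _ = sin (δ' - δ) := by rw [sub_sub_sub_cancel_left]

theorem abs_wave_le (hL : 0 ≤ L) : |wave δ L| ≤ L ^ (1 / 4 : ℝ) := by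
  have hroot : √√L = L ^ (1 / 4 : ℝ) := by
    rw [sqrt_eq_rpow, sqrt_eq_rpow, ← rpow_mul hL]; norm_num
  rw [wave, abs_mul, abs_of_nonneg (sqrt_nonneg _), ← hroot]
  exact mul_le_of_le_one_right (sqrt_nonneg _) (abs_cos_le_one _)

theorem continuous_wave : Continuous (wave δ) := by unfold wave; fun_prop

end Wave

section VariationOfConstants

/-- The source `n` is continuous on `(a, ∞)` and bounded there by `K s ^ (-(σ + 3 / 2))`, the decay
for which the oscillator has a solution of size `L ^ (-σ)`. -/
structure IsDecayingSource (a σ K : ℝ) (n : ℝ → ℝ) : Prop where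
  continuousOn : ContinuousOn n (Ioi a)
  abs_le : ∀ s, a < s → |n s| ≤ K * s ^ (-(σ + 3 / 2))

/-- The coefficients in the method of variation of constants. -/
def waveMoment (δ : ℝ) (n : ℝ → ℝ) (L : ℝ) : ℝ := ∫ s in Ioi L, wave δ s * n s

/-- The solution of `θ'' + (1 / L + 3 / (16 L ^ 2)) θ = n` that decays at infinity. -/
def decayingSolution (n : ℝ → ℝ) (L : ℝ) : ℝ :=
  wave 0 L * waveMoment (π / 2) n L - wave (π / 2) L * waveMoment 0 n L

/-- The derivative of `decayingSolution n`. -/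
def decayingSolutionDeriv (n : ℝ → ℝ) (L : ℝ) : ℝ :=
  waveDeriv 0 L * waveMoment (π / 2) n L - waveDeriv (π / 2) L * waveMoment 0 n L

namespace IsDecayingSource

variable {a σ K L s : ℝ} {n : ℝ → ℝ} (δ : ℝ)

theorem norm_wave_mul_le (hn : IsDecayingSource a σ K n) (ha : 0 ≤ a) (hs : a < s) :
    ‖wave δ s * n s‖ ≤ K * s ^ (-(σ + 5 / 4)) := by
  have hs0 : 0 < s := ha.trans_lt hs
  calc ‖wave δ s * n s‖ = |wave δ s| * |n s| := norm_mul _ _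
    _ ≤ s ^ (1 / 4 : ℝ) * (K * s ^ (-(σ + 3 / 2))) :=
      mul_le_mul (abs_wave_le δ hs0.le) (hn.abs_le s hs) (abs_nonneg _) (rpow_nonneg hs0.le _)
    _ = K * (s ^ (1 / 4 : ℝ) * s ^ (-(σ + 3 / 2))) := by ring
    _ = K * s ^ (-(σ + 5 / 4)) := by rw [← rpow_add hs0]; ring_nf

theorem ae_norm_wave_mul_le (hn : IsDecayingSource a σ K n) (ha : 0 ≤ a) (hL : a < L) :
    ∀ᵐ s ∂MeasureTheory.volume.restrict (Ioi L), ‖wave δ s * n s‖ ≤ K * s ^ (-(σ + 5 / 4)) :=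
  MeasureTheory.ae_restrict_of_forall_mem measurableSet_Ioi
    fun _ hs => hn.norm_wave_mul_le δ ha (hL.trans hs)

theorem continuousOn_wave_mul (hn : IsDecayingSource a σ K n) :
    ContinuousOn (fun s => wave δ s * n s) (Ioi a) :=
  (continuous_wave δ).continuousOn.mul hn.continuousOn

theorem integrableOn_wave_mul (hn : IsDecayingSource a σ K n) (ha : 0 ≤ a)
    (hσ : 0 < σ + 1 / 4) (hL : a < L) :
    MeasureTheory.IntegrableOn (fun s => wave δ s * n s) (Ioi L) :=
  ((integrableOn_Ioi_rpow_of_lt (by linarith) (ha.trans_lt hL)).const_mul K).mono'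
    (((hn.continuousOn_wave_mul δ).mono (Ioi_subset_Ioi hL.le)).aestronglyMeasurable
      measurableSet_Ioi) (hn.ae_norm_wave_mul_le δ ha hL)

theorem abs_waveMoment_le (hn : IsDecayingSource a σ K n) (ha : 0 ≤ a) (hσ : 0 < σ + 1 / 4)
    (hL : a < L) : |waveMoment δ n L| ≤ K / (σ + 1 / 4) * L ^ (-(σ + 1 / 4)) := by
  have hL0 : 0 < L := ha.trans_lt hL
  have hbound := MeasureTheory.norm_integral_le_of_norm_le
    ((integrableOn_Ioi_rpow_of_lt (by linarith) hL0).const_mul K)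
    (hn.ae_norm_wave_mul_le δ ha hL)
  rw [MeasureTheory.integral_const_mul, integral_Ioi_rpow_of_lt (by linarith) hL0,
    show -(σ + 5 / 4) + 1 = -(σ + 1 / 4) by ring, neg_div_neg_eq] at hbound
  exact hbound.trans_eq (by ring)

theorem hasDerivAt_waveMoment (hn : IsDecayingSource a σ K n) (ha : 0 ≤ a)
    (hσ : 0 < σ + 1 / 4) (hL : a < L) :
    HasDerivAt (waveMoment δ n) (-(wave δ L * n L)) L := by
  obtain ⟨b, hab, hbL⟩ := exists_between hL
  exact hasDerivAt_integral_Ioi (hn.integrableOn_wave_mul δ ha hσ hab)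
    ((hn.continuousOn_wave_mul δ).continuousAt (Ioi_mem_nhds hL)) hbL

theorem hasDerivAt_decayingSolution (hn : IsDecayingSource a σ K n) (ha : 0 ≤ a)
    (hσ : 0 < σ + 1 / 4) (hL : a < L) :
    HasDerivAt (decayingSolution n) (decayingSolutionDeriv n L) L := by
  have hL0 : 0 < L := ha.trans_lt hL
  refine (((hasDerivAt_wave 0 hL0).mul (hn.hasDerivAt_waveMoment (π / 2) ha hσ hL)).sub
    ((hasDerivAt_wave (π / 2) hL0).mul (hn.hasDerivAt_waveMoment 0 ha hσ hL))).congr_deriv ?_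
  rw [decayingSolutionDeriv]
  ring

theorem hasDerivAt_decayingSolutionDeriv (hn : IsDecayingSource a σ K n) (ha : 0 ≤ a)
    (hσ : 0 < σ + 1 / 4) (hL : a < L) :
    HasDerivAt (decayingSolutionDeriv n)
      (n L - (1 / L + 3 / (16 * L ^ 2)) * decayingSolution n L) L := by
  have hL0 : 0 < L := ha.trans_lt hL
  have hwronskian : wave 0 L * waveDeriv (π / 2) L - wave (π / 2) L * waveDeriv 0 L = 1 := by
    rw [wave_mul_waveDeriv_sub 0 hL0, sub_zero, sin_pi_div_two]
  refine (((hasDerivAt_waveDeriv 0 hL0).mul (hn.hasDerivAt_waveMoment (π / 2) ha hσ hL)).sub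
    ((hasDerivAt_waveDeriv (π / 2) hL0).mul
      (hn.hasDerivAt_waveMoment 0 ha hσ hL))).congr_deriv ?_
  rw [decayingSolution]
  linear_combination n L * hwronskian

theorem abs_rpow_mul_decayingSolution_le (hn : IsDecayingSource a σ K n) (ha : 0 ≤ a)
    (hσ : 0 < σ + 1 / 4) (hL : a < L) :
    |L ^ σ * decayingSolution n L| ≤ 2 * K / (σ + 1 / 4) := by
  have hL0 : 0 < L := ha.trans_lt hL
  have hterm : ∀ δ δ', |wave δ L * waveMoment δ' n L| ≤ K / (σ + 1 / 4) * L ^ (-σ) := by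
    intro δ δ'
    calc |wave δ L * waveMoment δ' n L|
        ≤ L ^ (1 / 4 : ℝ) * (K / (σ + 1 / 4) * L ^ (-(σ + 1 / 4))) := by
          rw [abs_mul]
          exact mul_le_mul (abs_wave_le δ hL0.le) (hn.abs_waveMoment_le δ' ha hσ hL)
            (abs_nonneg _) (rpow_nonneg hL0.le _)
      _ = K / (σ + 1 / 4) * (L ^ (1 / 4 : ℝ) * L ^ (-(σ + 1 / 4))) := by ring
      _ = K / (σ + 1 / 4) * L ^ (-σ) := by rw [← rpow_add hL0]; ring_nf
  calc |L ^ σ * decayingSolution n L| = L ^ σ * |decayingSolution n L| := by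
        rw [abs_mul, abs_of_pos (rpow_pos_of_pos hL0 σ)]
    _ ≤ L ^ σ * (K / (σ + 1 / 4) * L ^ (-σ) + K / (σ + 1 / 4) * L ^ (-σ)) := by
        gcongr
        exact (abs_sub _ _).trans (add_le_add (hterm _ _) (hterm _ _))
    _ = 2 * K / (σ + 1 / 4) * (L ^ σ * L ^ (-σ)) := by ring
    _ = 2 * K / (σ + 1 / 4) := by rw [← rpow_add hL0, add_neg_cancel, rpow_zero, mul_one]

theorem decayingSolution_sub {K' : ℝ} {n' : ℝ → ℝ} (hn : IsDecayingSource a σ K n)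
    (hn' : IsDecayingSource a σ K' n') (ha : 0 ≤ a) (hσ : 0 < σ + 1 / 4) (hL : a < L) :
    decayingSolution (n - n') L = decayingSolution n L - decayingSolution n' L := by
  have hmoment : ∀ δ, waveMoment δ (n - n') L = waveMoment δ n L - waveMoment δ n' L := by
    intro δ
    simp only [waveMoment, Pi.sub_apply, mul_sub]
    exact MeasureTheory.integral_sub (hn.integrableOn_wave_mul δ ha hσ hL)
      (hn'.integrableOn_wave_mul δ ha hσ hL)
  simp only [decayingSolution, hmoment]
  ring

end IsDecayingSource

end VariationOfConstants

section WeakForcing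

open BoundedContinuousFunction

/-- The forcing `M`, a function of `s > a` and of the rescaled unknown `s ^ σ * θ s`, is a decaying
source (with constant `K`) at `0`, and is Lipschitz in the unknown at the same rate (with
constant `k`). -/
structure IsWeakForcing (a σ K k : ℝ) (M : ℝ → ℝ → ℝ) : Prop where
  continuousOn : ContinuousOn (Function.uncurry M) (Ioi a ×ˢ univ)
  abs_zero_le : ∀ s, a < s → |M s 0| ≤ K * s ^ (-(σ + 3 / 2))
  abs_sub_le : ∀ s, a < s → ∀ c d, |M s c - M s d| ≤ k * |c - d| * s ^ (-(σ + 3 / 2))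

/-- The fixed-point map of `θ'' + (1 / L + 3 / (16 L ^ 2)) θ = M L (L ^ σ θ)` for the rescaled
unknown `L ^ σ θ`, extended to the real line by its value at `b`. -/
def forcedUpdate (b σ : ℝ) (M : ℝ → ℝ → ℝ) (z : ℝ → ℝ) (L : ℝ) : ℝ :=
  max L b ^ σ * decayingSolution (fun s => M s (z s)) (max L b)

namespace IsWeakForcing

variable {a b σ K k : ℝ} {M : ℝ → ℝ → ℝ}

theorem lipschitz_const_nonneg (hM : IsWeakForcing a σ K k M) (ha : 0 ≤ a) : 0 ≤ k := by
  have hle := (abs_nonneg _).trans (hM.abs_sub_le (a + 1) (lt_add_one a) 1 0)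
  rw [sub_zero, abs_one, mul_one] at hle
  exact nonneg_of_mul_nonneg_left hle (rpow_pos_of_pos (by linarith) _)

theorem isDecayingSource_comp (hM : IsWeakForcing a σ K k M) (ha : 0 ≤ a) (z : ℝ →ᵇ ℝ) :
    IsDecayingSource a σ (K + k * ‖z‖) fun s => M s (z s) where
  continuousOn := hM.continuousOn.comp (f := fun s => (s, z s)) (by fun_prop)
    fun _ hs => ⟨hs, mem_univ _⟩
  abs_le s hs := by
    have hk := hM.lipschitz_const_nonneg ha
    have hs0 : 0 < s := ha.trans_lt hs
    have hz : |z s - 0| ≤ ‖z‖ := by simpa using z.norm_coe_le_norm s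
    calc |M s (z s)| = |(M s (z s) - M s 0) + M s 0| := by rw [sub_add_cancel]
      _ ≤ k * |z s - 0| * s ^ (-(σ + 3 / 2)) + K * s ^ (-(σ + 3 / 2)) :=
        (abs_add_le _ _).trans (add_le_add (hM.abs_sub_le s hs _ _) (hM.abs_zero_le s hs))
      _ ≤ k * ‖z‖ * s ^ (-(σ + 3 / 2)) + K * s ^ (-(σ + 3 / 2)) := by gcongr
      _ = (K + k * ‖z‖) * s ^ (-(σ + 3 / 2)) := by ring

theorem isDecayingSource_comp_sub (hM : IsWeakForcing a σ K k M) (ha : 0 ≤ a) (z w : ℝ →ᵇ ℝ) :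
    IsDecayingSource a σ (k * dist z w) ((fun s => M s (z s)) - fun s => M s (w s)) where
  continuousOn := (hM.isDecayingSource_comp ha z).continuousOn.sub
    (hM.isDecayingSource_comp ha w).continuousOn
  abs_le s hs := by
    have hk := hM.lipschitz_const_nonneg ha
    have hs0 : 0 < s := ha.trans_lt hs
    have hdist : |z s - w s| ≤ dist z w := (Real.dist_eq _ _).symm.trans_le (dist_coe_le_dist s)
    calc |M s (z s) - M s (w s)| ≤ k * |z s - w s| * s ^ (-(σ + 3 / 2)) := hM.abs_sub_le s hs _ _
      _ ≤ k * dist z w * s ^ (-(σ + 3 / 2)) := by gcongr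

theorem continuous_forcedUpdate (hM : IsWeakForcing a σ K k M) (ha : 0 ≤ a) (hab : a < b)
    (hσ : 0 < σ + 1 / 4) (z : ℝ →ᵇ ℝ) : Continuous (forcedUpdate b σ M z) := by
  have hsolution : ContinuousOn (fun L => L ^ σ * decayingSolution (fun s => M s (z s)) L)
      (Ioi a) := fun L hL =>
    ((continuousAt_id.rpow_const (Or.inl (ha.trans_lt hL).ne')).mul
      ((hM.isDecayingSource_comp ha z).hasDerivAt_decayingSolution ha hσ
        hL).continuousAt).continuousWithinAt
  exact hsolution.comp_continuous (by fun_prop) fun _ => lt_max_of_lt_right hab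

theorem norm_forcedUpdate_le (hM : IsWeakForcing a σ K k M) (ha : 0 ≤ a) (hab : a < b)
    (hσ : 0 < σ + 1 / 4) (z : ℝ →ᵇ ℝ) (L : ℝ) :
    ‖forcedUpdate b σ M z L‖ ≤ 2 * (K + k * ‖z‖) / (σ + 1 / 4) :=
  (hM.isDecayingSource_comp ha z).abs_rpow_mul_decayingSolution_le ha hσ (lt_max_of_lt_right hab)

theorem dist_forcedUpdate_le (hM : IsWeakForcing a σ K k M) (ha : 0 ≤ a) (hab : a < b)
    (hσ : 0 < σ + 1 / 4) (z w : ℝ →ᵇ ℝ) (L : ℝ) :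
    dist (forcedUpdate b σ M z L) (forcedUpdate b σ M w L) ≤
      2 * k / (σ + 1 / 4) * dist z w := by
  have hL : a < max L b := lt_max_of_lt_right hab
  have hz := hM.isDecayingSource_comp ha z
  have hw := hM.isDecayingSource_comp ha w
  have hbound := (hM.isDecayingSource_comp_sub ha z w).abs_rpow_mul_decayingSolution_le ha hσ hL
  rw [hz.decayingSolution_sub hw ha hσ hL, mul_sub] at hbound
  exact hbound.trans_eq (by ring)

theorem exists_forcedUpdate_fixedPoint (hM : IsWeakForcing a σ K k M) (ha : 0 ≤ a) (hab : a < b)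
    (hσ : 0 < σ + 1 / 4) (hk : 2 * k < σ + 1 / 4) :
    ∃ z : ℝ →ᵇ ℝ, forcedUpdate b σ M z = z ∧ ‖z‖ ≤ 2 * K / (σ + 1 / 4 - 2 * k) := by
  let T : (ℝ →ᵇ ℝ) → (ℝ →ᵇ ℝ) := fun z => ofNormedAddCommGroup (forcedUpdate b σ M z)
    (hM.continuous_forcedUpdate ha hab hσ z) _ (hM.norm_forcedUpdate_le ha hab hσ z)
  have hrate : 0 ≤ 2 * k / (σ + 1 / 4) :=
    div_nonneg (mul_nonneg zero_le_two (hM.lipschitz_const_nonneg ha)) hσ.le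
  have hT : ContractingWith ⟨2 * k / (σ + 1 / 4), hrate⟩ T :=
    ⟨(div_lt_one hσ).2 hk, LipschitzWith.of_dist_le_mul fun z w =>
      (dist_le (mul_nonneg hrate dist_nonneg)).2 fun L => hM.dist_forcedUpdate_le ha hab hσ z w L⟩
  have hfix : T (hT.fixedPoint T) = hT.fixedPoint T := hT.fixedPoint_isFixedPt
  refine ⟨hT.fixedPoint T, congrArg DFunLike.coe hfix, ?_⟩
  set z := hT.fixedPoint T
  have hnorm : ‖T z‖ ≤ 2 * (K + k * ‖z‖) / (σ + 1 / 4) :=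
    norm_ofNormedAddCommGroup_le _
      ((norm_nonneg _).trans (hM.norm_forcedUpdate_le ha hab hσ z 0)) _
  rw [hfix, le_div_iff₀ hσ] at hnorm
  rw [le_div_iff₀ (sub_pos.2 hk)]
  linarith

theorem exists_decayingSolution (hM : IsWeakForcing a σ K k M) (ha : 0 ≤ a) (hab : a < b)
    (hk : 2 * k < σ + 1 / 4) : ∃ θ θ' : ℝ → ℝ, ∀ L, b ≤ L →
      |L ^ σ * θ L| ≤ 2 * K / (σ + 1 / 4 - 2 * k) ∧ HasDerivAt θ (θ' L) L ∧
      HasDerivAt θ' (M L (L ^ σ * θ L) - (1 / L + 3 / (16 * L ^ 2)) * θ L) L := by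
  have hσ : 0 < σ + 1 / 4 := by linarith [hM.lipschitz_const_nonneg ha]
  obtain ⟨z, hfix, hnorm⟩ := hM.exists_forcedUpdate_fixedPoint ha hab hσ hk
  have hsource := hM.isDecayingSource_comp ha z
  refine ⟨decayingSolution fun s => M s (z s), decayingSolutionDeriv fun s => M s (z s),
    fun L hL => ?_⟩
  have haL : a < L := hab.trans_le hL
  have hz : L ^ σ * decayingSolution (fun s => M s (z s)) L = z L := by
    rw [← congrFun hfix L, forcedUpdate, max_eq_left hL]
  rw [hz]
  exact ⟨(z.norm_coe_le_norm L).trans hnorm, hsource.hasDerivAt_decayingSolution ha hσ haL,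
    hsource.hasDerivAt_decayingSolutionDeriv ha hσ haL⟩

end IsWeakForcing

end WeakForcing

section Ansatz

variable {L : ℝ}

/-- The second order correction in the expansion of `exp y` for a solution `y` of the profile
equation `y'' = -exp (-L + exp y) / 4`; its coefficients cancel the terms of the residual of order
`log L / L ^ 3` and `1 / L ^ 3`. -/
def ansatzCorr (L : ℝ) : ℝ := (4 * log L - 4 * log 2 - 6) / L

/-- An approximation of `exp y` for a solution `y` of the profile equation
`y'' = -exp (-L + exp y) / 4`. -/
def ansatz (L : ℝ) : ℝ := L - 2 * log L + 2 * log 2 + ansatzCorr L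

/-- The relative deviation of `ansatz L` from `L`. -/
def ansatzRel (L : ℝ) : ℝ := (-2 * log L + 2 * log 2 + ansatzCorr L) / L

/-- The derivative of `ansatz`. -/
def ansatzDeriv (L : ℝ) : ℝ := 1 - 2 / L + (10 - 4 * log L + 4 * log 2) / L ^ 2

/-- The second derivative of `ansatz`. -/
def ansatzDeriv₂ (L : ℝ) : ℝ := 2 / L ^ 2 + (8 * log L - 8 * log 2 - 24) / L ^ 3

/-- The second derivative of `log ∘ ansatz`. -/
def logAnsatzDeriv₂ (L : ℝ) : ℝ :=
  (ansatzDeriv₂ L * ansatz L - ansatzDeriv L ^ 2) / ansatz L ^ 2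

/-- The residual of `log ∘ ansatz` in the profile equation. -/
def ansatzResidual (L : ℝ) : ℝ := 1 / 4 * exp (-L + ansatz L) + logAnsatzDeriv₂ L

theorem hasDerivAt_ansatz (hL : 0 < L) : HasDerivAt ansatz (ansatzDeriv L) L := by
  have hlog := hasDerivAt_log hL.ne'
  have hcorr := (((hlog.const_mul 4).sub_const (4 * log 2)).sub_const 6).div (hasDerivAt_id L)
    hL.ne'
  refine ((((hasDerivAt_id L).sub (hlog.const_mul 2)).add_const (2 * log 2)).add
    hcorr).congr_deriv ?_
  simp only [id, ansatzDeriv]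
  field_simp
  ring

theorem hasDerivAt_ansatzDeriv (hL : 0 < L) : HasDerivAt ansatzDeriv (ansatzDeriv₂ L) L := by
  have hlog := hasDerivAt_log hL.ne'
  have hquot := (((hlog.const_mul 4).const_sub 10).add_const (4 * log 2)).div (hasDerivAt_pow 2 L)
    (pow_ne_zero 2 hL.ne')
  have hinv := (hasDerivAt_const L (2 : ℝ)).div (hasDerivAt_id L) hL.ne'
  refine ((hinv.const_sub 1).add hquot).congr_deriv ?_
  simp only [id, ansatzDeriv₂]
  field_simp
  ring

theorem hasDerivAt_logAnsatzDeriv (hL : 0 < L) (hP : ansatz L ≠ 0) :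
    HasDerivAt (fun s => ansatzDeriv s / ansatz s) (logAnsatzDeriv₂ L) L :=
  ((hasDerivAt_ansatzDeriv hL).div (hasDerivAt_ansatz hL) hP).congr_deriv
    (by rw [logAnsatzDeriv₂, sq (ansatzDeriv L)])

theorem ansatz_eq_mul_one_add (hL : L ≠ 0) : ansatz L = L * (1 + ansatzRel L) := by
  rw [ansatz, ansatzRel]
  field_simp
  ring

theorem exp_neg_add_ansatz (hL : 0 < L) :
    1 / 4 * exp (-L + ansatz L) = exp (ansatzCorr L) / L ^ 2 := by
  have hexponent : -L + ansatz L = ansatzCorr L + (log 2 + log 2) - (log L + log L) := by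
    rw [ansatz]
    ring
  rw [hexponent, exp_sub, exp_add (ansatzCorr L), exp_add (log 2), exp_add (log L),
    exp_log two_pos, exp_log hL]
  ring

theorem affine_log_div_isBigO (c d : ℝ) :
    (fun L : ℝ => (c * log L + d) / L) =O[atTop] fun L => log L / L :=
  (((isBigO_refl (fun L : ℝ => log L / L) atTop).const_mul_left c).add
    (const_div_isBigO_log_div d)).congr_left fun L => by ring

theorem affine_log_div_sq_isBigO (c d : ℝ) :
    (fun L : ℝ => (c * log L + d) / L ^ 2) =O[atTop] fun L => (log L / L) ^ 2 :=
  ((affine_log_div_isBigO c d).mul (const_div_isBigO_log_div 1)).congr (fun L => by ring)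
    fun L => by ring

theorem ansatzCorr_isBigO : ansatzCorr =O[atTop] fun L => log L / L :=
  (affine_log_div_isBigO 4 (-4 * log 2 - 6)).congr_left fun L => by rw [ansatzCorr]; ring

theorem tendsto_ansatzCorr : Tendsto ansatzCorr atTop (𝓝 0) :=
  ansatzCorr_isBigO.trans_tendsto tendsto_log_div_self

theorem ansatzRel_isBigO : ansatzRel =O[atTop] fun L => log L / L :=
  ((affine_log_div_isBigO (-2) (2 * log 2)).add
    (isBigO_mul_of_isBigO_one (const_div_isBigO_log_div 1)
      (tendsto_ansatzCorr.isBigO_one ℝ))).congr_left fun L => by rw [ansatzRel]; ring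

theorem tendsto_ansatzRel : Tendsto ansatzRel atTop (𝓝 0) :=
  ansatzRel_isBigO.trans_tendsto tendsto_log_div_self

theorem tendsto_one_add_ansatzRel : Tendsto (fun L => 1 + ansatzRel L) atTop (𝓝 1) := by
  simpa using tendsto_ansatzRel.const_add 1

theorem exp_ansatzCorr_sub_isBigO :
    (fun L => exp (ansatzCorr L) - 1 - ansatzCorr L) =O[atTop] fun L => (log L / L) ^ 2 := by
  refine IsBigO.trans (IsBigO.of_bound' ?_) (ansatzCorr_isBigO.pow 2)
  filter_upwards [tendsto_ansatzCorr.eventually (Icc_mem_nhds neg_one_lt_zero one_pos)] with L hL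
  rw [norm_eq_abs, norm_of_nonneg (sq_nonneg _)]
  exact abs_exp_sub_one_sub_id_le (abs_le.2 hL)

theorem sq_mul_exp_ansatzCorr_isBigO :
    (fun L => (1 + ansatzRel L) ^ 2 * exp (ansatzCorr L) - (1 + 2 * ansatzRel L + ansatzCorr L))
      =O[atTop] fun L => (log L / L) ^ 2 := by
  have hexp := isBigO_mul_of_isBigO_one exp_ansatzCorr_sub_isBigO
    ((tendsto_one_add_ansatzRel.pow 2).isBigO_one ℝ)
  have hrel := isBigO_mul_of_isBigO_one (ansatzRel_isBigO.mul ansatzRel_isBigO)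
    ((tendsto_ansatzCorr.const_add 1).isBigO_one ℝ)
  have hmixed := (ansatzRel_isBigO.mul ansatzCorr_isBigO).const_mul_left 2
  simp only [← sq] at hrel hmixed
  exact ((hexp.add hrel).add hmixed).congr_left fun L => by ring

theorem ansatzDeriv_sq_sub_isBigO :
    (fun L => ansatzDeriv L ^ 2 - (1 - 4 / L)) =O[atTop] fun L => (log L / L) ^ 2 := by
  have hleading : Tendsto (fun L : ℝ => 1 - 2 / L) atTop (𝓝 1) := by
    simpa using (tendsto_const_nhds (x := (2 : ℝ)).div_atTop tendsto_id).const_sub 1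
  have hrest : (fun L => ansatzDeriv L - (1 - 2 / L)) =O[atTop] fun L => (log L / L) ^ 2 :=
    (affine_log_div_sq_isBigO (-4) (10 + 4 * log 2)).congr_left fun L => by
      rw [ansatzDeriv]
      ring
  have hone : (fun L : ℝ => (log L / L) ^ 2) =O[atTop] fun _ => (1 : ℝ) :=
    (tendsto_log_div_self.pow 2).isBigO_one ℝ
  have hsq := isBigO_mul_sub_mul hrest hrest (hleading.isBigO_one ℝ) (hleading.isBigO_one ℝ) hone
  exact (hsq.add (affine_log_div_sq_isBigO 0 4)).congr_left fun L => by ring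

theorem one_add_ansatzRel_mul_ansatzDeriv₂_isBigO :
    (fun L => (1 + ansatzRel L) * (L * ansatzDeriv₂ L) - 2 / L)
      =O[atTop] fun L => (log L / L) ^ 2 := by
  have hsecond := isBigO_mul_of_isBigO_one (affine_log_div_sq_isBigO 8 (-8 * log 2 - 24))
    (tendsto_one_add_ansatzRel.isBigO_one ℝ)
  have hrel := ansatzRel_isBigO.mul (const_div_isBigO_log_div 2)
  simp only [← sq] at hrel
  refine (hsecond.add hrel).congr' ?_ EventuallyEq.rfl
  filter_upwards [eventually_gt_atTop 0] with L hL
  rw [ansatzDeriv₂]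
  field_simp
  ring

theorem two_mul_ansatzRel_add_isBigO :
    (fun L => 2 * ansatzRel L + ansatzCorr L + 6 / L) =O[atTop] fun L => (log L / L) ^ 2 := by
  have hprod := (const_div_isBigO_log_div 2).mul ansatzCorr_isBigO
  simp only [← sq] at hprod
  refine hprod.congr' ?_ EventuallyEq.rfl
  filter_upwards [eventually_gt_atTop 0] with L hL
  rw [ansatzRel, ansatzCorr]
  field_simp
  ring

theorem ansatzResidual_isBigO :
    ansatzResidual =O[atTop] fun L => (log L / L) ^ 2 * (L ^ 2)⁻¹ := by
  have hnumerator := ((sq_mul_exp_ansatzCorr_isBigO.sub ansatzDeriv_sq_sub_isBigO).add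
    one_add_ansatzRel_mul_ansatzDeriv₂_isBigO).add two_mul_ansatzRel_add_isBigO
  have hdenominator := ((tendsto_one_add_ansatzRel.pow 2).inv₀ (by simp)).isBigO_one ℝ
  refine ((isBigO_mul_of_isBigO_one hnumerator hdenominator).mul
    (isBigO_refl (fun L : ℝ => (L ^ 2)⁻¹) atTop)).congr' ?_ EventuallyEq.rfl
  filter_upwards [eventually_gt_atTop 0, tendsto_one_add_ansatzRel.eventually_ne one_ne_zero]
    with L hL hrel
  rw [ansatzResidual, exp_neg_add_ansatz hL, logAnsatzDeriv₂, ansatz_eq_mul_one_add hL.ne']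
  field_simp
  ring

theorem sq_log_div_mul_inv_sq_isLittleO :
    (fun L : ℝ => (log L / L) ^ 2 * (L ^ 2)⁻¹) =o[atTop] fun L => L ^ (-(7 / 2) : ℝ) := by
  have hlog := ((isLittleO_log_rpow_atTop (r := 1 / 4) (by norm_num)).pow two_pos).mul_isBigO
    (isBigO_refl (fun L : ℝ => (L ^ 4)⁻¹) atTop)
  refine hlog.congr' (.of_forall fun L => by ring) ?_
  filter_upwards [eventually_gt_atTop 0] with L hL
  rw [← rpow_natCast, ← rpow_natCast, ← rpow_mul hL.le, ← rpow_neg hL.le, ← rpow_add hL]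
  norm_num

theorem ansatzResidual_isLittleO : ansatzResidual =o[atTop] fun L => L ^ (-(7 / 2) : ℝ) :=
  ansatzResidual_isBigO.trans_isLittleO sq_log_div_mul_inv_sq_isLittleO

end Ansatz

section ProfileForcing

variable {L θ : ℝ}

/-- The forcing in the equation `θ'' + (1 / L + 3 / (16 L ^ 2)) θ = profileForcing L θ`, which says
that `log (ansatz L) + θ L` solves the profile equation. -/
def profileForcing (L θ : ℝ) : ℝ :=
  (1 / L + 3 / (16 * L ^ 2)) * θ - 1 / 4 * exp (-L + ansatz L * exp θ) - logAnsatzDeriv₂ L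

/-- The derivative of `profileForcing` in its second argument. -/
def profileForcingDeriv (L θ : ℝ) : ℝ :=
  1 / L + 3 / (16 * L ^ 2) - 1 / 4 * exp (-L + ansatz L * exp θ) * (ansatz L * exp θ)

theorem profileForcing_zero (L : ℝ) : profileForcing L 0 = -ansatzResidual L := by
  rw [profileForcing, ansatzResidual, exp_zero, mul_one]
  ring

theorem hasDerivAt_profileForcing (L θ : ℝ) :
    HasDerivAt (profileForcing L) (profileForcingDeriv L θ) θ := by
  refine ((((hasDerivAt_id θ).const_mul (1 / L + 3 / (16 * L ^ 2))).sub
    ((((hasDerivAt_exp θ).const_mul (ansatz L)).const_add (-L)).exp.const_mul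
      (1 / 4))).sub_const (logAnsatzDeriv₂ L)).congr_deriv ?_
  rw [profileForcingDeriv]
  ring

theorem profileForcingDeriv_eq (hL : 0 < L) : profileForcingDeriv L θ = 1 / L * (3 / 16 * (1 / L) +
    -((1 + ansatzRel L) * (exp (ansatzCorr L + ansatz L * (exp θ - 1) + θ) - 1)) +
      -ansatzRel L) := by
  have hexponent : -L + ansatz L * exp θ = (-L + ansatz L) + ansatz L * (exp θ - 1) := by ring
  rw [profileForcingDeriv, hexponent, exp_add (-L + ansatz L), ← mul_assoc (1 / 4 : ℝ),
    exp_neg_add_ansatz hL, exp_add, exp_add, ansatz_eq_mul_one_add hL.ne']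
  field_simp
  ring

theorem abs_ansatz_exponent_le (hL : 1 ≤ L) (hrel : |ansatzRel L| ≤ 1) (hθ : |θ| ≤ 1 / L ^ 2) :
    |ansatzCorr L + ansatz L * (exp θ - 1) + θ| ≤ |ansatzCorr L| + 5 / L := by
  have hL0 : 0 < L := one_pos.trans_le hL
  have hθ_le_inv : |θ| ≤ 1 / L := hθ.trans (by gcongr; exact le_self_pow₀ hL two_ne_zero)
  have hθ_le_one : |θ| ≤ 1 := hθ_le_inv.trans ((div_le_one hL0).2 hL)
  have hansatz : |ansatz L| ≤ L * 2 := by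
    rw [ansatz_eq_mul_one_add hL0.ne', abs_mul, abs_of_pos hL0]
    gcongr
    linarith [abs_add_le 1 (ansatzRel L), abs_one (α := ℝ)]
  have hincrement : |ansatz L * (exp θ - 1)| ≤ 4 / L := by
    calc |ansatz L * (exp θ - 1)| ≤ L * 2 * (2 * (1 / L ^ 2)) := by
          rw [abs_mul]
          gcongr
          exact (abs_exp_sub_one_le hθ_le_one).trans (by gcongr)
      _ = 4 / L := by
          field_simp
          norm_num
  calc |ansatzCorr L + ansatz L * (exp θ - 1) + θ|
      ≤ |ansatzCorr L| + |ansatz L * (exp θ - 1)| + |θ| := abs_add_three _ _ _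
    _ ≤ |ansatzCorr L| + 4 / L + 1 / L := by gcongr
    _ = |ansatzCorr L| + 5 / L := by ring

theorem abs_profileForcingDeriv_le (hL : 1 ≤ L) (hrel : |ansatzRel L| ≤ 1)
    (hcorr : |ansatzCorr L| + 5 / L ≤ 1) (hθ : |θ| ≤ 1 / L ^ 2) :
    |profileForcingDeriv L θ| ≤
      1 / L * (|ansatzRel L| + 4 * |ansatzCorr L| + 21 / L) := by
  have hL0 : 0 < L := one_pos.trans_le hL
  have hexponent := abs_ansatz_exponent_le hL hrel hθ
  set η := ansatzCorr L + ansatz L * (exp θ - 1) + θ with hη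
  have hexp : |exp η - 1| ≤ 2 * (|ansatzCorr L| + 5 / L) :=
    (abs_exp_sub_one_le (hexponent.trans hcorr)).trans (by gcongr)
  have hprod : |(1 + ansatzRel L) * (exp η - 1)| ≤ 2 * (2 * (|ansatzCorr L| + 5 / L)) := by
    rw [abs_mul]
    gcongr
    linarith [abs_add_le 1 (ansatzRel L), abs_one (α := ℝ)]
  have hsum := abs_add_three (3 / 16 * (1 / L)) (-((1 + ansatzRel L) * (exp η - 1)))
    (-ansatzRel L)
  have hinv : 0 < 1 / L := one_div_pos.2 hL0
  rw [abs_neg, abs_neg, abs_of_pos (show 0 < 3 / 16 * (1 / L) by positivity)] at hsum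
  rw [profileForcingDeriv_eq hL0, ← hη, abs_mul, abs_of_pos hinv]
  gcongr
  rw [← mul_one_div] at hprod
  rw [← mul_one_div 21]
  linarith

theorem eventually_abs_profileForcingDeriv_le : ∀ᶠ L in atTop, ∀ θ, |θ| ≤ 1 / L ^ 2 →
    |profileForcingDeriv L θ| ≤ 1 / 2 * L ^ (-(3 / 2) : ℝ) := by
  have hsmall : Tendsto (fun L => √L * (|ansatzRel L| + 4 * |ansatzCorr L| + 21 / L)) atTop
      (𝓝 0) := by
    refine tendsto_mul_of_isBigO ?_ tendsto_sqrt_mul_log_div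
    simpa only [norm_eq_abs] using (ansatzRel_isBigO.norm_left.add
      (ansatzCorr_isBigO.norm_left.const_mul_left 4)).add (const_div_isBigO_log_div 21)
  filter_upwards [hsmall.eventually (ge_mem_nhds one_half_pos), eventually_ge_atTop 1]
    with L hbound hL θ hθ
  have hL0 : 0 < L := one_pos.trans_le hL
  have hsum : |ansatzRel L| + 4 * |ansatzCorr L| + 21 / L ≤ 1 / 2 :=
    (le_mul_of_one_le_left (by positivity) (one_le_sqrt.2 hL)).trans hbound
  have hrel := abs_nonneg (ansatzRel L)
  have hcorr := abs_nonneg (ansatzCorr L)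
  have hinv : 0 < 1 / L := one_div_pos.2 hL0
  rw [← mul_one_div] at hsum
  calc |profileForcingDeriv L θ| ≤ 1 / L * (|ansatzRel L| + 4 * |ansatzCorr L| + 21 / L) :=
        abs_profileForcingDeriv_le hL (by linarith) (by rw [← mul_one_div]; linarith) hθ
    _ ≤ 1 / L * (1 / 2 / √L) := by
        gcongr
        rwa [le_div_iff₀' (sqrt_pos.2 hL0)]
    _ = 1 / 2 * L ^ (-(3 / 2) : ℝ) := by
        rw [show (-(3 / 2) : ℝ) = -1 + -(1 / 2) by norm_num, rpow_add hL0, rpow_neg_one,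
          rpow_neg hL0.le, ← sqrt_eq_rpow]
        ring

theorem eventually_abs_profileForcing_zero_le :
    ∀ᶠ L in atTop, |profileForcing L 0| ≤ 1 / 4 * L ^ (-(7 / 2) : ℝ) := by
  filter_upwards [ansatzResidual_isLittleO.bound (c := 1 / 4) (by norm_num),
    eventually_gt_atTop 0] with L hbound hL
  rwa [norm_of_nonneg (rpow_pos_of_pos hL _).le, norm_eq_abs, ← abs_neg,
    ← profileForcing_zero] at hbound

end ProfileForcing

section TruncatedForcing

variable {a s : ℝ}

/-- Truncation of the real line to `[-1, 1]`. -/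
def truncation (c : ℝ) : ℝ := projIcc (-1) 1 (neg_le_self zero_le_one) c

/-- `profileForcing` as a function of the rescaled unknown `c = L ^ 2 * θ`, truncated to
`[-1, 1]`. -/
def truncatedForcing (L c : ℝ) : ℝ :=
  profileForcing L (truncation c / L ^ 2)

theorem truncatedForcing_sq_mul {L θ : ℝ} (hL : L ≠ 0) (hθ : |L ^ 2 * θ| ≤ 1) :
    truncatedForcing L (L ^ 2 * θ) = profileForcing L θ := by
  rw [truncatedForcing, truncation, projIcc_of_mem _ (abs_le.1 hθ),
    mul_div_cancel_left₀ _ (pow_ne_zero 2 hL)]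

theorem continuousOn_logAnsatzDeriv₂ (ha : 0 ≤ a) (hP : ∀ L, a < L → ansatz L ≠ 0) :
    ContinuousOn logAnsatzDeriv₂ (Ioi a) := by
  have hpos : ∀ L ∈ Ioi a, 0 < L := fun L hL => ha.trans_lt hL
  have hansatz : ContinuousOn ansatz (Ioi a) := HasDerivAt.continuousOn
    fun L hL => hasDerivAt_ansatz (hpos L hL)
  have hderiv : ContinuousOn ansatzDeriv (Ioi a) := HasDerivAt.continuousOn
    fun L hL => hasDerivAt_ansatzDeriv (hpos L hL)
  have hlog : ContinuousOn log (Ioi a) := continuousOn_log.mono fun L hL => (hpos L hL).ne'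
  have hderiv₂ : ContinuousOn ansatzDeriv₂ (Ioi a) :=
    (continuousOn_const.div (by fun_prop) fun L hL => pow_ne_zero 2 (hpos L hL).ne').add
      (ContinuousOn.div (by fun_prop) (by fun_prop) fun L hL => pow_ne_zero 3 (hpos L hL).ne')
  exact ((hderiv₂.mul hansatz).sub (hderiv.pow 2)).div (hansatz.pow 2)
    fun L hL => pow_ne_zero 2 (hP L hL)

theorem continuousOn_truncatedForcing (ha : 0 ≤ a) (hP : ∀ L, a < L → ansatz L ≠ 0) :
    ContinuousOn (Function.uncurry truncatedForcing) (Ioi a ×ˢ univ) := by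
  have hfst : MapsTo Prod.fst (Ioi a ×ˢ (univ : Set ℝ)) (Ioi a) := fun _ hz => hz.1
  have hne : ∀ z ∈ Ioi a ×ˢ (univ : Set ℝ), z.1 ≠ 0 := fun _ hz => (ha.trans_lt hz.1).ne'
  have hansatz : ContinuousOn (fun z : ℝ × ℝ => ansatz z.1) (Ioi a ×ˢ univ) :=
    ContinuousOn.comp (HasDerivAt.continuousOn fun L hL => hasDerivAt_ansatz (ha.trans_lt hL))
      continuousOn_fst hfst
  have hsecond : ContinuousOn (fun z : ℝ × ℝ => logAnsatzDeriv₂ z.1) (Ioi a ×ˢ univ) :=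
    (continuousOn_logAnsatzDeriv₂ ha hP).comp continuousOn_fst hfst
  have hcoeff : ContinuousOn (fun z : ℝ × ℝ => 1 / z.1 + 3 / (16 * z.1 ^ 2)) (Ioi a ×ˢ univ) :=
    (continuousOn_const.div continuousOn_fst hne).add (continuousOn_const.div (by fun_prop)
      fun z hz => mul_ne_zero (by norm_num) (pow_ne_zero 2 (hne z hz)))
  have hproj : Continuous fun z : ℝ × ℝ => truncation z.2 :=
    continuous_subtype_val.comp (continuous_projIcc.comp continuous_snd)
  have hunknown : ContinuousOn
      (fun z : ℝ × ℝ => truncation z.2 / z.1 ^ 2) (Ioi a ×ˢ univ) :=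
    hproj.continuousOn.div (continuousOn_fst.pow 2) fun z hz => pow_ne_zero 2 (hne z hz)
  exact ((hcoeff.mul hunknown).sub (continuousOn_const.mul
    (continuousOn_fst.neg.add (hansatz.mul hunknown.rexp)).rexp)).sub hsecond

theorem abs_truncatedForcing_sub_le {k : ℝ} (hs : 0 < s) (hderiv : ∀ θ, |θ| ≤ 1 / s ^ 2 →
    |profileForcingDeriv s θ| ≤ k * s ^ (-(3 / 2) : ℝ)) (c d : ℝ) :
    |truncatedForcing s c - truncatedForcing s d| ≤ k * |c - d| * s ^ (-(7 / 2) : ℝ) := by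
  have hs2 : 0 < s ^ 2 := pow_pos hs 2
  have hk : 0 ≤ k * s ^ (-(3 / 2) : ℝ) :=
    (abs_nonneg _).trans (hderiv 0 (by rw [abs_zero]; positivity))
  have hmem : ∀ c, truncation c / s ^ 2 ∈ Icc (-(1 / s ^ 2)) (1 / s ^ 2) := fun c => by
    rw [mem_Icc, ← abs_le, abs_div, abs_of_pos hs2]
    gcongr
    exact abs_le.2 (projIcc (-1 : ℝ) 1 (neg_le_self zero_le_one) c).2
  have hmean := (convex_Icc (-(1 / s ^ 2)) (1 / s ^ 2)).norm_image_sub_le_of_norm_hasDerivWithin_le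
    (fun θ _ => (hasDerivAt_profileForcing s θ).hasDerivWithinAt)
    (fun θ hθ => hderiv θ (abs_le.2 hθ)) (hmem d) (hmem c)
  rw [norm_eq_abs, norm_eq_abs, ← sub_div, abs_div, abs_of_pos hs2] at hmean
  have hpow : s ^ (-(7 / 2) : ℝ) = s ^ (-(3 / 2) : ℝ) / s ^ 2 := by
    rw [← rpow_natCast, ← rpow_sub hs]
    norm_num
  calc |truncatedForcing s c - truncatedForcing s d|
      ≤ k * s ^ (-(3 / 2) : ℝ) * (|truncation c - truncation d| / s ^ 2) := hmean
    _ ≤ k * s ^ (-(3 / 2) : ℝ) * (|c - d| / s ^ 2) := by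
        gcongr ?_ * (?_ / ?_)
        exact abs_projIcc_sub_projIcc _
    _ = k * |c - d| * s ^ (-(7 / 2) : ℝ) := by
        rw [hpow]
        ring

theorem tendsto_ansatz_div : Tendsto (fun L => ansatz L / L) atTop (𝓝 1) := by
  refine tendsto_one_add_ansatzRel.congr' ?_
  filter_upwards [eventually_ne_atTop 0] with L hL
  rw [ansatz_eq_mul_one_add hL, mul_div_cancel_left₀ _ hL]

theorem tendsto_ansatz : Tendsto ansatz atTop atTop := by
  refine (tendsto_id.atTop_mul_pos one_pos tendsto_one_add_ansatzRel).congr' ?_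
  filter_upwards [eventually_ne_atTop 0] with L hL
  rw [id, ansatz_eq_mul_one_add hL]

theorem exists_isWeakForcing_truncatedForcing : ∃ a, 0 ≤ a ∧ (∀ L, a < L → 0 < ansatz L) ∧
    IsWeakForcing a 2 (1 / 4) (1 / 2) truncatedForcing := by
  obtain ⟨a, ha⟩ := eventually_atTop.1 ((eventually_abs_profileForcing_zero_le.and
    eventually_abs_profileForcingDeriv_le).and
      ((tendsto_ansatz.eventually_gt_atTop 0).and (eventually_ge_atTop 0)))
  have ha0 : 0 ≤ a := (ha a le_rfl).2.2
  have hP : ∀ L, a < L → 0 < ansatz L := fun L hL => (ha L hL.le).2.1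
  have hexp : (-(2 + 3 / 2) : ℝ) = -(7 / 2) := by norm_num
  refine ⟨a, ha0, hP, continuousOn_truncatedForcing ha0 fun L hL => (hP L hL).ne',
    fun s hs => ?_, fun s hs c d => ?_⟩
  · have hzero := truncatedForcing_sq_mul (θ := 0) (ha0.trans_lt hs).ne' (by simp)
    rw [mul_zero] at hzero
    rw [hzero, hexp]
    exact (ha s hs.le).1.1
  · rw [hexp]
    exact abs_truncatedForcing_sub_le (ha0.trans_lt hs) (ha s hs.le).1.2 c d

end TruncatedForcing

section ExistenceOfProfile

theorem exists_ansatz_correction : ∃ (a : ℝ) (θ θ' : ℝ → ℝ), 0 ≤ a ∧ ∀ L, a < L →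
    0 < ansatz L ∧ |L ^ 2 * θ L| ≤ 1 ∧ HasDerivAt θ (θ' L) L ∧
      HasDerivAt θ' (-(1 / 4 * exp (-L + ansatz L * exp (θ L))) - logAnsatzDeriv₂ L) L := by
  obtain ⟨a, ha, hP, hforcing⟩ := exists_isWeakForcing_truncatedForcing
  obtain ⟨θ, θ', hθ⟩ := hforcing.exists_decayingSolution ha (lt_add_one a) (by norm_num)
  refine ⟨a + 1, θ, θ', by linarith, fun L hL => ?_⟩
  obtain ⟨hbound, hderiv, hderiv₂⟩ := hθ L hL.le
  rw [rpow_two] at hbound hderiv₂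
  have hsmall : |L ^ 2 * θ L| ≤ 1 := hbound.trans (by norm_num)
  refine ⟨hP L (by linarith), hsmall, hderiv, hderiv₂.congr_deriv ?_⟩
  rw [truncatedForcing_sq_mul (by linarith) hsmall, profileForcing]
  ring

theorem contDiff_doubleExp_one : ContDiff ℝ ∞ (doubleExp 1) := by
  have heq : doubleExp 1 = fun s => exp (exp s) := funext fun s => by rw [doubleExp, rpow_one]
  rw [heq]
  fun_prop

theorem isBigO_log_div_sq_of_abs_sq_mul_le {a : ℝ} {θ : ℝ → ℝ}
    (hθ : ∀ L, a < L → |L ^ 2 * θ L| ≤ 1) : θ =O[atTop] fun L => log L / L ^ 2 := by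
  refine IsBigO.of_bound' ?_
  filter_upwards [eventually_gt_atTop a, eventually_ge_atTop (exp 1)] with L hL he
  have hL0 : 0 < L := (exp_pos 1).trans_le he
  have hlog : 1 ≤ log L := (le_log_iff_exp_le hL0).2 he
  have hbound := hθ L hL
  rw [abs_mul, abs_of_pos (pow_pos hL0 2)] at hbound
  rw [norm_eq_abs, norm_of_nonneg (by positivity), le_div_iff₀' (by positivity)]
  exact hbound.trans hlog

theorem tendsto_log_div_sq : Tendsto (fun L : ℝ => log L / L ^ 2) atTop (𝓝 0) := by
  have hprod := tendsto_log_div_self.mul tendsto_inv_atTop_zero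
  rw [mul_zero] at hprod
  exact hprod.congr fun L => by ring

theorem exists_isRadialProfile_doubleExp_one : ∃ (L₀ : ℝ) (y y' : ℝ → ℝ),
    IsRadialProfile (doubleExp 1) L₀ y y' ∧ (∀ L, L₀ < L → 0 ≤ y L) ∧ Tendsto y atTop atTop ∧
      (fun L => y L - log (ansatz L)) =O[atTop] fun L => log L / L ^ 2 := by
  obtain ⟨a, θ, θ', ha, hθ⟩ := exists_ansatz_correction
  have hdecay : θ =O[atTop] fun L => log L / L ^ 2 :=
    isBigO_log_div_sq_of_abs_sq_mul_le fun L hL => (hθ L hL).2.1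
  have hlim : Tendsto (fun L => log (ansatz L) + θ L) atTop atTop :=
    (tendsto_log_atTop.comp tendsto_ansatz).atTop_add (hdecay.trans_tendsto tendsto_log_div_sq)
  obtain ⟨b, hb⟩ := eventually_atTop.1 (hlim.eventually_ge_atTop 0)
  refine ⟨max a b, _, fun L => ansatzDeriv L / ansatz L + θ' L, ⟨fun L hL => ?_, fun L hL => ?_⟩,
    fun L hL => hb L ((le_max_right _ _).trans hL.le), hlim, by simpa using hdecay⟩ <;>
  obtain ⟨hP, -, hderiv, hderiv₂⟩ := hθ L ((le_max_left _ _).trans_lt hL) <;>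
  have hL0 : 0 < L := ha.trans_lt ((le_max_left _ _).trans_lt hL)
  · exact ((hasDerivAt_ansatz hL0).log hP.ne').add hderiv
  · refine ((hasDerivAt_logAnsatzDeriv hL0 hP.ne').add hderiv₂).congr_deriv ?_
    rw [doubleExp, rpow_one, exp_add (log (ansatz L)), exp_log hP, exp_add]
    ring

end ExistenceOfProfile

section Expansion

theorem log_sub_log_isBigO {α : Type*} {l : Filter α} {u v e : α → ℝ}
    (hdiv : (fun s => v s / u s - 1) =O[l] e) (he : Tendsto e l (𝓝 0)) :
    (fun s => log (v s) - log (u s)) =O[l] e := by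
  have hlim : Tendsto (fun s => v s / u s) l (𝓝 1) := by
    simpa using (hdiv.trans_tendsto he).add_const 1
  have hlog := ((hasDerivAt_log one_ne_zero).isBigO_sub.comp_tendsto hlim).trans hdiv
  refine hlog.congr' ?_ EventuallyEq.rfl
  filter_upwards [hlim.eventually_ne one_ne_zero] with s hs
  obtain ⟨hv, hu⟩ := div_ne_zero_iff.1 hs
  rw [Function.comp_apply, log_one, sub_zero, log_div hv hu]

theorem log_neg_log_modelTail_sub_log_isBigO :
    (fun L => log (-log (modelTail L)) - log L) =O[atTop] fun L => log L / L :=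
  log_sub_log_isBigO neg_log_modelTail_div_sub_one_isBigO tendsto_log_div_self

/-- `-log w - log (-log w)` at `w = modelTail L`, whose logarithm is the leading part of the
expansion of the singular solution. -/
def expansionProfile (L : ℝ) : ℝ := -log (modelTail L) - log (-log (modelTail L))

theorem expansionProfile_sub_ansatz_isBigO :
    (fun L => expansionProfile L - ansatz L) =O[atTop] fun L => log L / L := by
  have hlog_add_one : (fun L : ℝ => log (L + 1) - log L) =O[atTop] fun L => log L / L :=
    log_add_one_sub_log_isBigO.trans (by simpa using const_div_isBigO_log_div 1)
  have hlog_four : log 4 = 2 * log 2 := by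
    rw [show (4 : ℝ) = 2 ^ 2 by norm_num, log_pow, Nat.cast_ofNat]
  refine ((ansatzCorr_isBigO.add hlog_add_one).add
    log_neg_log_modelTail_sub_log_isBigO).neg_left.congr' ?_ EventuallyEq.rfl
  filter_upwards [eventually_gt_atTop 0] with L hL
  rw [expansionProfile, ansatz]
  linear_combination -neg_log_modelTail hL - hlog_four

theorem log_expansionProfile_sub_log_ansatz_isBigO :
    (fun L => log (expansionProfile L) - log (ansatz L)) =O[atTop] fun L => log L / L ^ 2 := by
  have hinv := (tendsto_ansatz_div.inv₀ one_ne_zero).isBigO_one ℝ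
  have hrel := (isBigO_mul_of_isBigO_one expansionProfile_sub_ansatz_isBigO hinv).mul
    (isBigO_refl (fun L : ℝ => L⁻¹) atTop)
  refine log_sub_log_isBigO (hrel.congr' ?_ ?_) tendsto_log_div_sq
  · filter_upwards [eventually_ne_atTop 0, tendsto_ansatz.eventually_ne_atTop 0] with L hL hP
    field_simp
  · exact .of_forall fun L => by ring

theorem log_neg_log_modelTail_div_sq_isEquivalent :
    (fun L => log (-log (modelTail L)) / (-log (modelTail L)) ^ 2) ~[atTop]
      fun L => log L / L ^ 2 := by
  have hlog : (fun L => -log (modelTail L)) ~[atTop] fun L => L :=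
    isEquivalent_of_tendsto_one tendsto_neg_log_modelTail_div
  exact (hlog.log tendsto_id).div (hlog.pow 2)

theorem wFun_eq_modelTail {x : Plane} (hx : x ≠ 0) :
    wFun x = modelTail (log (1 / ‖x‖ ^ 2)) := by
  have hpos : 0 < 1 / ‖x‖ ^ 2 := one_div_pos.2 (pow_pos (norm_pos_iff.2 hx) 2)
  rw [wFun, modelTail, exp_neg, exp_log hpos, one_div (‖x‖ ^ 2), inv_inv]
  ring

theorem exists_singularSolution_doubleExp_one :
    ∃ R : ℝ, 0 < R ∧ ∃ u : Plane → ℝ, IsSmoothSingularSolution (doubleExp 1) R u ∧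
      (fun x : Plane => u x - log (-log (wFun x) - log (-log (wFun x)))) =O[𝓝[≠] 0]
        fun x : Plane => log (-log (wFun x)) / (-log (wFun x)) ^ 2 := by
  obtain ⟨L₀, y, y', hy, hpos, hlim, hansatz⟩ := exists_isRadialProfile_doubleExp_one
  refine ⟨exp (-L₀ / 2), exp_pos _, fun x => y (log (1 / ‖x‖ ^ 2)),
    hy.isSmoothSingularSolution contDiff_doubleExp_one hpos hlim, ?_⟩
  have hexpansion := (hansatz.sub log_expansionProfile_sub_log_ansatz_isBigO).trans
    log_neg_log_modelTail_div_sq_isEquivalent.isBigO_symm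
  refine (hexpansion.comp_tendsto tendsto_log_one_div_norm_sq).congr' ?_ ?_ <;>
  filter_upwards [self_mem_nhdsWithin] with x hx <;>
  simp only [Function.comp, wFun_eq_modelTail hx, expansionProfile, sub_sub_sub_cancel_right]

end Expansion

end SingularSol

end

theorem mainTheorem5_general :
    (∀ q : ℝ, 0 < q → SingularSol.HasGrowthExponent (SingularSol.doubleExp q) 1) ∧
    (∀ q : ℝ, 0 < q →
      (SingularSol.DiscrepancyCondition (SingularSol.doubleExp q) 1 ↔ q = 1)) ∧
    (∃ R : ℝ, 0 < R ∧ ∃ u : SingularSol.Plane → ℝ,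
      SingularSol.IsSmoothSingularSolution (SingularSol.doubleExp 1) R u ∧
      (fun x : SingularSol.Plane =>
          u x - log (-log (SingularSol.wFun x) - log (-log (SingularSol.wFun x))))
        =O[𝓝[≠] 0]
      (fun x : SingularSol.Plane =>
          log (-log (SingularSol.wFun x)) / (-log (SingularSol.wFun x)) ^ 2)) :=
  ⟨fun _ hq => SingularSol.hasGrowthExponent_doubleExp hq,
    fun _ hq => SingularSol.discrepancyCondition_doubleExp_iff hq,
    SingularSol.exists_singularSolution_doubleExp_one⟩

theorem mainTheorem5 :
    (∀ q : ℝ, 1 ≤ q → SingularSol.HasGrowthExponent (SingularSol.doubleExp q) 1) ∧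
    SingularSol.DiscrepancyCondition (SingularSol.doubleExp 1) 1 ∧
    (∀ q : ℝ, 1 < q → ¬ SingularSol.DiscrepancyCondition (SingularSol.doubleExp q) 1) ∧
    (∃ R : ℝ, 0 < R ∧ ∃ u : SingularSol.Plane → ℝ,
      SingularSol.IsSmoothSingularSolution (SingularSol.doubleExp 1) R u ∧
      (fun x : SingularSol.Plane =>
          u x - log (-log (SingularSol.wFun x) - log (-log (SingularSol.wFun x))))
        =O[𝓝[≠] 0]
      (fun x : SingularSol.Plane =>
          log (-log (SingularSol.wFun x)) / (-log (SingularSol.wFun x)) ^ 2)) := by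
  obtain ⟨hgrowth, hdiscrepancy, hsolution⟩ := mainTheorem5_general
  exact ⟨fun q hq => hgrowth q (one_pos.trans_le hq), (hdiscrepancy 1 one_pos).2 rfl,
    fun q hq h => hq.ne' ((hdiscrepancy q (one_pos.trans hq)).1 h), hsolution⟩
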